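/- Let $K\subset\mathbb{C}$ be a connected, simply connected, compact set, let $\Omega$ be the unbounded component of $\mathbb{C}\setminus K$, and assume that $\Gamma=\partial\Omega$ is a real analytic curve, i.e. the image of a periodic real analytic map $\gamma:\mathbb{R}\to\mathbb{C}$ with $\gamma'\neq0$ everywhere which is injective on a period. Let $\Phi$ be a conformal map of $\Omega$ onto $\{w\in\mathbb{C}:|w|>1\}$, let $\mu$ be a finite positive Borel measure on $\Gamma$, and let $z\in\Omega$. For $n\ge 0$ put $$\lambda_n(\mu,z)=\inf\Big\{\int|p|^2\,d\mu:\ p \text{ a polynomial of degree at most } n,\ p(z)=1\Big\},\qquad \tilde\lambda_n(\mu,z)=|\Phi(z)|^{2n}\lambda_n(\mu,z),$$ and $\tilde\lambda_\infty(\mu,z)=\liminf_{n\to\infty}\tilde\lambda_n(\mu,z)$. Let $A_e(\Gamma)$ be the set of complex-valued functions that are continuous on the closure of $\Omega\cup\{\infty\}$ in the Riemann sphere and analytic on $\Omega\cup\{\infty\}$. Then $$\tilde\lambda_\infty(\mu,z)=\inf\Big\{\int|f|^2\,d\mu:\ f\in A_e(\Gamma),\ f(z)=1\Big\},$$ and moreover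 the limit exists: $\tilde\lambda_\infty(\mu,z)=\lim_{n\to\infty}\tilde\lambda_n(\mu,z)$. -/

import Mathlib

open Filter Topology MeasureTheory

/-- The unbounded component of the complement of `K`: the points outside `K` whose connected
component in `ℂ \ K` is unbounded. (For compact `K` there is exactly one such component.) -/
def unboundedComponent (K : Set ℂ) : Set ℂ :=
  {z | z ∈ Kᶜ ∧ ¬ Bornology.IsBounded (connectedComponentIn Kᶜ z)}

/-- A (regular, simple, closed) real analytic curve in the plane: the trace of a `1`-periodic
real analytic map with nowhere vanishing derivative that is injective on a period. -/
def IsRealAnalyticJordanCurve (Γ : Set ℂ) : Prop :=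
  ∃ γ : ℝ → ℂ, AnalyticOnNhd ℝ γ Set.univ ∧ (∀ t, deriv γ t ≠ 0) ∧ Function.Periodic γ 1 ∧
    Set.InjOn γ (Set.Ico 0 1) ∧ Set.range γ = Γ

/-- `Φ` maps `Ω` conformally (holomorphically and bijectively) onto the exterior `{w : |w| > 1}` of
the closed unit disk. The values of `Φ` outside `Ω` play no role. -/
def IsConformalOntoExterior (Φ : ℂ → ℂ) (Ω : Set ℂ) : Prop :=
  DifferentiableOn ℂ Φ Ω ∧ Set.BijOn Φ Ω {w : ℂ | 1 < ‖w‖}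

/-- The Christoffel function
`λ_n(μ, z) = inf {∫ |p|² dμ : p a polynomial of degree at most n, p(z) = 1}`. -/
noncomputable def christoffelFn (μ : Measure ℂ) (n : ℕ) (z : ℂ) : ℝ :=
  sInf {t : ℝ | ∃ p : Polynomial ℂ, p.natDegree ≤ n ∧ p.eval z = 1 ∧
    t = ∫ w, ‖p.eval w‖ ^ 2 ∂μ}

/-- The normalized Christoffel function `|Φ(z)|^{2n} λ_n(μ, z)`. -/
noncomputable def normChristoffelFn (Φ : ℂ → ℂ) (μ : Measure ℂ) (n : ℕ) (z : ℂ) : ℝ :=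
  ‖Φ z‖ ^ (2 * n) * christoffelFn μ n z

/-- The lower limit of the normalized Christoffel functions as `n → ∞`. -/
noncomputable def normChristoffelFnInf (Φ : ℂ → ℂ) (μ : Measure ℂ) (z : ℂ) : ℝ :=
  liminf (fun n : ℕ => normChristoffelFn Φ μ n z) atTop

/-- The class of functions on the Riemann sphere `ℂ ∪ {∞}` that are continuous on the closure (in
the sphere) of `Ω ∪ {∞}` and analytic on `Ω ∪ {∞}`, analyticity at `∞` being read in the chart
`w = 1 / ζ`. -/
def IsExteriorDiskAlgebra (Ω : Set ℂ) (f : OnePoint ℂ → ℂ) : Prop :=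
  ContinuousOn f (closure (((↑) : ℂ → OnePoint ℂ) '' Ω ∪ {OnePoint.infty})) ∧
  AnalyticOnNhd ℂ (fun w : ℂ => f (w : OnePoint ℂ)) Ω ∧
  AnalyticAt ℂ (fun w : ℂ => if w = 0 then f OnePoint.infty else f ((w⁻¹ : ℂ) : OnePoint ℂ)) 0

/-! Division by powers of `Φ` turns the extremal problem for polynomials into one for the exterior
algebra. If `p` has degree at most `n` and `p(z) = 1`, then `f = Φ(z)^n p / Φ^n` is analytic on `Ω`
and at infinity, because `Φ` has a simple pole there. It is continuous up to `Γ` with `f(z) = 1`,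
and since `|Φ| = 1` on `Γ`, `∫|f|² dμ = |Φ(z)|^{2n} ∫|p|² dμ`. So every normalized Christoffel value
dominates the infimum over the algebra (`exteriorSzegoInf_le_normChristoffelFn`).

Conversely, for `f` in the algebra, `Φ^n f` is nearly a polynomial of degree `n`. In the coordinate
`1/Φ` the function `f` lies in the disk algebra, so it is uniformly close to some `Q(1/Φ)`, and `Φ^n
Q(1/Φ)` is a combination of the powers `Φ^{n-k}` with `k ≤ deg Q`. The Faber polynomial of degree at
most `m` differs from `Φ^m` by `O(s^m)` with `s < 1`, up to and including `Γ`
(`exists_faber_approximation`). Normalizing at `z` puts the limsup below `∫|f|² dμ`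
(`eventually_normChristoffelFn_lt`). The two bounds give the limit and its value.

The geometric Faber error is where analyticity of `Γ` enters: the inverse `Ψ` of `Φ` must extend
holomorphically to `|w| > r` for some `r < 1` (`exists_extension`). The parametrization of `Γ`
complexifies to an injective map `J` of an annulus. In this coordinate `J⁻¹ ∘ Ψ` has modulus tending
to one at the unit circle, so it continues by Schwarz reflection. Reflection is carried out with
Cauchy integrals, so no continuous boundary values are assumed beforehand. -/

/-! ### The unbounded component, and inverses of injective holomorphic maps -/

theorem isPreconnected_norm_preimage {S : Set ℝ} (hS : IsPreconnected S) (h0 : ∀ x ∈ S, 0 ≤ x) :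
    IsPreconnected {w : ℂ | ‖w‖ ∈ S} := by
  have h : {w : ℂ | ‖w‖ ∈ S} =
      (fun p : ℝ × ℝ => (p.1 : ℂ) * Complex.exp (p.2 * Complex.I)) '' (S ×ˢ Set.univ) := by
    ext w
    constructor
    · intro hw
      exact ⟨(‖w‖, w.arg), ⟨hw, trivial⟩, Complex.norm_mul_exp_arg_mul_I w⟩
    · rintro ⟨⟨s, t⟩, ⟨hs, -⟩, rfl⟩
      have : ‖(s : ℂ) * Complex.exp (t * Complex.I)‖ = s := by
        rw [norm_mul, Complex.norm_exp_ofReal_mul_I, mul_one, Complex.norm_real,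
          Real.norm_of_nonneg (h0 s hs)]
      change ‖_‖ ∈ S
      rw [this]
      exact hs
  rw [h]
  exact (hS.prod isPreconnected_univ).image _ (by fun_prop)

theorem isOpen_unboundedComponent {K : Set ℂ} (hK : IsCompact K) :
    IsOpen (unboundedComponent K) := by
  rw [isOpen_iff_mem_nhds]
  rintro z ⟨hz, hb⟩
  have ho : IsOpen (connectedComponentIn Kᶜ z) := hK.isClosed.isOpen_compl.connectedComponentIn
  filter_upwards [ho.mem_nhds (mem_connectedComponentIn hz)] with w hw
  exact ⟨connectedComponentIn_subset _ _ hw, by rwa [← connectedComponentIn_eq hw]⟩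

theorem exists_norm_gt_subset_unboundedComponent {K : Set ℂ} (hK : IsCompact K) :
    ∃ M : ℝ, 0 < M ∧ {z : ℂ | M < ‖z‖} ⊆ unboundedComponent K := by
  obtain ⟨M, hM0, hM⟩ := hK.isBounded.exists_pos_norm_le
  refine ⟨M, hM0, fun z hz => ?_⟩
  have hsub : {w : ℂ | M < ‖w‖} ⊆ Kᶜ := fun w hw hwK => (hM w hwK).not_gt hw
  have hc : IsPreconnected {w : ℂ | M < ‖w‖} :=
    isPreconnected_norm_preimage (S := Set.Ioi M) isPreconnected_Ioi
      fun x hx => hM0.le.trans (le_of_lt hx)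
  refine ⟨hsub hz, fun hb => ?_⟩
  obtain ⟨C, hC0, hC⟩ := (hb.subset (hc.subset_connectedComponentIn hz hsub)).exists_pos_norm_le
  have h1 : ‖((M + C : ℝ) : ℂ)‖ = M + C := by
    rw [Complex.norm_real, Real.norm_of_nonneg (by positivity)]
  have := hC ((M + C : ℝ) : ℂ) (by simp only [Set.mem_ofPred_eq, h1]; linarith)
  linarith

/-- Open mapping theorem: the other alternative, local constancy, contradicts injectivity because
points of the plane are not isolated. -/
theorem nhds_le_map_nhds_of_injOn {f : ℂ → ℂ} {U : Set ℂ} (hU : IsOpen U)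
    (hf : DifferentiableOn ℂ f U) (hinj : Set.InjOn f U) {z : ℂ} (hz : z ∈ U) :
    𝓝 (f z) ≤ map f (𝓝 z) := by
  refine (hf.analyticAt (hU.mem_nhds hz)).eventually_constant_or_nhds_le_map_nhds.resolve_left ?_
  intro h
  have h2 : ∀ᶠ w in 𝓝 z, w = z := by
    filter_upwards [h, hU.mem_nhds hz] with w hw hwU
    exact hinj hwU hz hw
  exact (NeBot.ne (inferInstance : (𝓝[≠] z).NeBot)) (by
    rw [← Filter.eventually_false_iff_eq_bot, eventually_nhdsWithin_iff]
    filter_upwards [h2] with w hw hne using hne hw)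

theorem isOpen_image_of_injOn {f : ℂ → ℂ} {U : Set ℂ} (hU : IsOpen U)
    (hf : DifferentiableOn ℂ f U) (hinj : Set.InjOn f U) : IsOpen (f '' U) := by
  rw [isOpen_iff_mem_nhds]
  rintro _ ⟨z, hz, rfl⟩
  exact nhds_le_map_nhds_of_injOn hU hf hinj hz (image_mem_map (hU.mem_nhds hz))

theorem continuousAt_leftInverse_of_injOn {f g : ℂ → ℂ} {U : Set ℂ} (hU : IsOpen U)
    (hf : DifferentiableOn ℂ f U) (hg : Set.LeftInvOn g f U) {z : ℂ} (hz : z ∈ U) :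
    ContinuousAt g (f z) := by
  intro N hN
  rw [hg hz] at hN
  have := nhds_le_map_nhds_of_injOn hU hf hg.injOn hz (image_mem_map (inter_mem hN (hU.mem_nhds hz)))
  rw [mem_map]
  refine mem_of_superset this ?_
  rintro _ ⟨w, ⟨hwN, hwU⟩, rfl⟩
  simpa [hg hwU] using hwN

/-- The inverse of an injective holomorphic function is holomorphic. -/
theorem differentiableOn_leftInverse_of_injOn {f g : ℂ → ℂ} {U : Set ℂ} (hU : IsOpen U)
    (hf : DifferentiableOn ℂ f U) (hg : Set.LeftInvOn g f U) :
    DifferentiableOn ℂ g (f '' U) := by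
  have hV := isOpen_image_of_injOn hU hf hg.injOn
  have key : ∀ z ∈ U, deriv f z ≠ 0 → DifferentiableAt ℂ g (f z) := by
    intro z hz hd
    refine (HasDerivAt.of_local_left_inverse (f := f) (f' := deriv f z)
      (continuousAt_leftInverse_of_injOn hU hf hg hz) ?_ hd ?_).differentiableAt
    · rw [hg hz]; exact (hf.differentiableAt (hU.mem_nhds hz)).hasDerivAt
    · filter_upwards [hV.mem_nhds ⟨z, hz, rfl⟩]
      rintro _ ⟨w, hw, rfl⟩
      rw [hg hw]
  rintro _ ⟨z, hz, rfl⟩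
  have hcz := continuousAt_leftInverse_of_injOn hU hf hg hz
  have had : AnalyticAt ℂ (deriv f) z := (hf.analyticAt (hU.mem_nhds hz)).deriv
  -- Critical points of the injective `f` are isolated, and so are their images. At such an image
  -- the continuous `g` has a removable singularity.
  refine (AnalyticAt.differentiableAt
    (Complex.analyticAt_of_differentiable_on_punctured_nhds_of_continuousAt ?_
      hcz)).differentiableWithinAt
  rcases had.eventually_eq_zero_or_eventually_ne_zero with h | h
  · exfalso
    obtain ⟨ε, hε, hb⟩ := Metric.eventually_nhds_iff_ball.1 (h.and (hU.mem_nhds hz))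
    have hconst : ∀ w ∈ Metric.ball z ε, f w = f z := fun w hw =>
      (convex_ball z ε).is_const_of_fderivWithin_eq_zero (𝕜 := ℂ)
        (hf.mono fun w hw => (hb w hw).2)
        (fun w hw => by
          rw [fderivWithin_of_isOpen Metric.isOpen_ball hw]
          ext
          simpa using (hb w hw).1) hw (Metric.mem_ball_self hε)
    have hw : z + (ε / 2 : ℝ) ∈ Metric.ball z ε := by
      rw [Metric.mem_ball, dist_self_add_left, Complex.norm_real, Real.norm_of_nonneg (by positivity)]
      linarith
    have := hg.injOn (hb _ hw).2 hz (hconst _ hw)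
    simp at this
    exact hε.ne' this
  · rw [eventually_nhdsWithin_iff] at h ⊢
    have h3 : ∀ᶠ y in 𝓝 (f z), g y ≠ z → deriv f (g y) ≠ 0 := by
      have : Tendsto g (𝓝 (f z)) (𝓝 z) := by simpa [ContinuousAt, hg hz] using hcz
      exact this.eventually h
    filter_upwards [h3, hV.mem_nhds ⟨z, hz, rfl⟩]
    rintro _ hy ⟨w, hw, rfl⟩ hne
    rw [hg hw] at hy
    exact key w hw (hy fun h => hne (by rw [h]; rfl))

/-- The inverse is holomorphic, so the chain rule gives a product of derivatives equal to one. -/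
theorem deriv_ne_zero_of_injOn {f : ℂ → ℂ} {U : Set ℂ} (hU : IsOpen U)
    (hf : DifferentiableOn ℂ f U) (hinj : Set.InjOn f U) {z : ℂ} (hz : z ∈ U) :
    deriv f z ≠ 0 := by
  intro h0
  have hg := hinj.leftInvOn_invFunOn
  have hV := isOpen_image_of_injOn hU hf hinj
  have h1 := (differentiableOn_leftInverse_of_injOn hU hf hg).differentiableAt
    (hV.mem_nhds ⟨z, hz, rfl⟩)
  have h2 := h1.hasDerivAt.comp z (hf.differentiableAt (hU.mem_nhds hz)).hasDerivAt
  have h3 : HasDerivAt (Function.invFunOn f U ∘ f) 1 z :=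
    (hasDerivAt_id z).congr_of_eventuallyEq (by
      filter_upwards [hU.mem_nhds hz] with w hw using hg hw)
  simpa [h0] using h2.unique h3

theorem frequently_norm_gt {c : ℂ} {r : ℝ} (hc : r ≤ ‖c‖) (hr : 0 < r) :
    ∃ᶠ w in 𝓝 c, r < ‖w‖ := by
  have h : Tendsto (fun t : ℝ => (t : ℂ) * c) (𝓝[>] 1) (𝓝 c) := by
    have : Continuous fun t : ℝ => (t : ℂ) * c := by fun_prop
    simpa using (this.tendsto 1).mono_left nhdsWithin_le_nhds
  refine h.frequently (Eventually.frequently ?_)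
  filter_upwards [self_mem_nhdsWithin] with t ht
  have ht' : (1 : ℝ) < t := ht
  rw [norm_mul, Complex.norm_real, Real.norm_of_nonneg (by linarith)]
  nlinarith

/-! ### Behaviour of the conformal map and its inverse at infinity -/

/-- A conformal map onto the exterior of the unit disk has a pole at infinity. -/
theorem IsConformalOntoExterior.tendsto_cobounded {Φ : ℂ → ℂ} {Ω : Set ℂ}
    (hΦ : IsConformalOntoExterior Φ Ω) (hΩ : IsOpen Ω) {M : ℝ} (hM : 0 < M)
    (hMΩ : {z : ℂ | M < ‖z‖} ⊆ Ω) :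
    Tendsto Φ (Bornology.cobounded ℂ) (Bornology.cobounded ℂ) := by
  obtain ⟨hd, hb⟩ := hΦ
  -- In the chart at infinity `1/Φ` is bounded by one, so its singularity at zero is removable. What
  -- remains is that the limit `a` vanishes.
  set g : ℂ → ℂ := fun ξ => (Φ ξ⁻¹)⁻¹ with hgdef
  have hin : ∀ ξ : ℂ, ‖ξ‖ < M⁻¹ → ξ ≠ 0 → ξ⁻¹ ∈ Ω := fun ξ h1 h2 => hMΩ (by
    change M < ‖ξ⁻¹‖
    rw [norm_inv]; exact (lt_inv_comm₀ (norm_pos_iff.2 h2) hM).1 h1)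
  have hg1 : ∀ ξ : ℂ, ‖ξ‖ < M⁻¹ → ξ ≠ 0 → ‖g ξ‖ < 1 := fun ξ h1 h2 => by
    rw [hgdef]; simp only [norm_inv]
    exact inv_lt_one_of_one_lt₀ (hb.mapsTo (hin ξ h1 h2))
  have hgd : ∀ ξ : ℂ, ‖ξ‖ < M⁻¹ → ξ ≠ 0 → DifferentiableAt ℂ g ξ := fun ξ h1 h2 => by
    have h3 : DifferentiableAt ℂ Φ ξ⁻¹ := hd.differentiableAt (hΩ.mem_nhds (hin ξ h1 h2))
    refine (DifferentiableAt.comp (g := Φ) (f := fun x : ℂ => x⁻¹) ξ h3 (differentiableAt_inv h2)).inv ?_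
    have : 1 < ‖Φ ξ⁻¹‖ := hb.mapsTo (hin ξ h1 h2)
    exact norm_pos_iff.1 (one_pos.trans this)
  have hM' : (0 : ℝ) < M⁻¹ := inv_pos.2 hM
  have hball : Metric.ball (0 : ℂ) M⁻¹ ∈ 𝓝 (0 : ℂ) := Metric.ball_mem_nhds _ hM'
  have hdiff : DifferentiableOn ℂ g (Metric.ball 0 M⁻¹ \ {0}) := fun ξ hξ =>
    (hgd ξ (by simpa using hξ.1) hξ.2).differentiableWithinAt
  have hbdd : BddAbove (norm ∘ g '' (Metric.ball 0 M⁻¹ \ {0})) := by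
    refine ⟨1, ?_⟩
    rintro _ ⟨ξ, hξ, rfl⟩
    exact (hg1 ξ (by simpa using hξ.1) hξ.2).le
  have hext := Complex.differentiableOn_update_limUnder_of_bddAbove hball hdiff hbdd
  set a := limUnder (𝓝[≠] 0) g with ha
  set G := Function.update g 0 a with hG
  have hGan : AnalyticAt ℂ G 0 := hext.analyticAt hball
  have hGg : ∀ ξ, ξ ≠ 0 → G ξ = g ξ := fun ξ h => Function.update_of_ne h _ _
  have hG0 : G 0 = a := Function.update_self _ _ _
  have hglim : Tendsto g (𝓝[≠] 0) (𝓝 a) := by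
    have := hGan.continuousAt.tendsto.mono_left (nhdsWithin_le_nhds (s := {0}ᶜ))
    rw [hG0] at this
    exact this.congr' (by filter_upwards [self_mem_nhdsWithin] with ξ h using hGg ξ h)
  have ha0 : a = 0 := by
    by_contra hne
    have hinvlim : Tendsto (fun ξ => Φ ξ⁻¹) (𝓝[≠] 0) (𝓝 a⁻¹) := by
      simpa [hgdef] using hglim.inv₀ hne
    have hcl : 1 ≤ ‖a⁻¹‖ := by
      refine ge_of_tendsto hinvlim.norm ?_
      filter_upwards [self_mem_nhdsWithin, nhdsWithin_le_nhds hball] with ξ h1 h2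
      exact le_of_lt (hb.mapsTo (hin ξ (by simpa using h2) h1))
    have hpunct : ∀ᶠ ξ : ℂ in 𝓝[≠] 0, ξ ≠ 0 ∧ ‖ξ‖ < M⁻¹ := by
      filter_upwards [self_mem_nhdsWithin, nhdsWithin_le_nhds hball] with ξ h1 h2
      exact ⟨h1, by simpa using h2⟩
    -- If `|a| = 1`, the extension attains its maximum modulus at an interior point, against the
    -- open mapping theorem. If `|a| < 1`, then `a⁻¹ = Φ ζ` for a finite `ζ`, and continuity of the
    -- inverse would force `ξ⁻¹ → ζ` as `ξ → 0`.
    rcases hcl.eq_or_lt with h | h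
    · have ha1 : ‖a‖ = 1 := by rw [norm_inv] at h; exact inv_eq_one.1 h.symm
      rcases hGan.eventually_constant_or_nhds_le_map_nhds with hc | hc
      · obtain ⟨ξ, ⟨h1, h2⟩, h3⟩ := (hpunct.and (nhdsWithin_le_nhds hc)).exists
        rw [hGg ξ h1, hG0] at h3
        exact (hg1 ξ h2 h1).ne (by rw [h3, ha1])
      · have hfr := (frequently_norm_gt (c := G 0) (by rw [hG0, ha1]) one_pos).filter_mono hc
        rw [frequently_map] at hfr
        obtain ⟨ξ, h1, h2⟩ := (hfr.and_eventually hball).exists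
        rcases eq_or_ne ξ 0 with rfl | h3
        · rw [hG0, ha1] at h1; exact lt_irrefl _ h1
        · rw [hGg ξ h3] at h1
          exact (hg1 ξ (by simpa using h2) h3).not_gt h1
    · obtain ⟨ζ, hζ, hζa⟩ := hb.surjOn h
      have hcont := continuousAt_leftInverse_of_injOn hΩ hd hb.injOn.leftInvOn_invFunOn hζ
      rw [ContinuousAt, hb.injOn.leftInvOn_invFunOn hζ, hζa] at hcont
      have h4 : Tendsto (fun ξ : ℂ => ξ⁻¹) (𝓝[≠] 0) (𝓝 ζ) := by
        refine (hcont.comp hinvlim).congr' ?_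
        filter_upwards [hpunct] with ξ hξ
        exact hb.injOn.leftInvOn_invFunOn (hin ξ hξ.2 hξ.1)
      exact not_tendsto_nhds_of_tendsto_atTop tendsto_norm_inv_nhdsNE_zero_atTop _ h4.norm
  rw [ha0] at hglim
  have h5 : Tendsto g (𝓝[≠] 0) (𝓝[≠] 0) := tendsto_nhdsWithin_iff.2 ⟨hglim, by
    filter_upwards [self_mem_nhdsWithin, nhdsWithin_le_nhds hball] with ξ h1 h2
    have : 1 < ‖Φ ξ⁻¹‖ := hb.mapsTo (hin ξ (by simpa using h2) h1)
    exact inv_ne_zero (norm_pos_iff.1 (by linarith))⟩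
  have h6 := (Filter.tendsto_inv₀_nhdsNE_zero (α := ℂ)).comp (h5.comp tendsto_inv₀_cobounded')
  refine h6.congr fun z => ?_
  simp [hgdef]

/-- A function with a pole at infinity is the reciprocal of an analytic function of `1 / w`. -/
theorem exists_analyticAt_inv_of_tendsto_cobounded {f : ℂ → ℂ} {R : ℝ}
    (hf : DifferentiableOn ℂ f {w | R < ‖w‖})
    (hlim : Tendsto f (Bornology.cobounded ℂ) (Bornology.cobounded ℂ)) :
    ∃ g : ℂ → ℂ, AnalyticAt ℂ g 0 ∧ g 0 = 0 ∧ ∀ s ≠ 0, g s = (f s⁻¹)⁻¹ := by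
  have hg : ∀ s ≠ 0, Function.update (fun s => (f s⁻¹)⁻¹) 0 0 s = (f s⁻¹)⁻¹ := fun s hs =>
    Function.update_of_ne hs _ _
  refine ⟨Function.update (fun s => (f s⁻¹)⁻¹) 0 0, ?_, Function.update_self _ _ _, hg⟩
  have hne : ∀ᶠ s in 𝓝[≠] (0 : ℂ), f s⁻¹ ≠ 0 ∧ R < ‖s⁻¹‖ := by
    refine (hlim.comp tendsto_inv₀_nhdsNE_zero).eventually (Bornology.eventually_ne_cobounded 0) |>.and ?_
    exact tendsto_norm_inv_nhdsNE_zero_atTop.eventually (eventually_gt_atTop R)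
  refine Complex.analyticAt_of_differentiable_on_punctured_nhds_of_continuousAt ?_ ?_
  · filter_upwards [hne, self_mem_nhdsWithin] with s hs h0
    have hop : IsOpen {w : ℂ | R < ‖w‖} := isOpen_lt continuous_const continuous_norm
    have h3 : DifferentiableAt ℂ f s⁻¹ := hf.differentiableAt (hop.mem_nhds hs.2)
    have h4 : DifferentiableAt ℂ (fun s => (f s⁻¹)⁻¹) s :=
      (DifferentiableAt.comp (g := f) (f := fun x : ℂ => x⁻¹) s h3 (differentiableAt_inv h0)).inv
        hs.1
    refine h4.congr_of_eventuallyEq ?_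
    filter_upwards [isOpen_ne.mem_nhds h0] with t ht using hg t ht
  · rw [continuousAt_update_same]
    exact tendsto_inv₀_cobounded.comp (hlim.comp tendsto_inv₀_nhdsNE_zero)


/-- The inverse of a conformal map onto the exterior of the unit disk. -/
noncomputable def exteriorInverse (Φ : ℂ → ℂ) (Ω : Set ℂ) : ℂ → ℂ := Function.invFunOn Φ Ω

namespace IsConformalOntoExterior

variable {Φ : ℂ → ℂ} {Ω : Set ℂ}

theorem leftInvOn (hΦ : IsConformalOntoExterior Φ Ω) : Set.LeftInvOn (exteriorInverse Φ Ω) Φ Ω :=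
  hΦ.2.injOn.leftInvOn_invFunOn

theorem inverse_mem (hΦ : IsConformalOntoExterior Φ Ω) {w : ℂ} (hw : 1 < ‖w‖) :
    exteriorInverse Φ Ω w ∈ Ω :=
  Function.invFunOn_mem (hΦ.2.surjOn hw)

theorem apply_inverse (hΦ : IsConformalOntoExterior Φ Ω) {w : ℂ} (hw : 1 < ‖w‖) :
    Φ (exteriorInverse Φ Ω w) = w :=
  Function.invFunOn_eq (hΦ.2.surjOn hw)

theorem injOn_inverse (hΦ : IsConformalOntoExterior Φ Ω) :
    Set.InjOn (exteriorInverse Φ Ω) {w | 1 < ‖w‖} := fun a ha b hb h => by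
  rw [← hΦ.apply_inverse ha, h, hΦ.apply_inverse hb]

theorem differentiableOn_inverse (hΦ : IsConformalOntoExterior Φ Ω) (hΩ : IsOpen Ω) :
    DifferentiableOn ℂ (exteriorInverse Φ Ω) {w | 1 < ‖w‖} := by
  have := differentiableOn_leftInverse_of_injOn hΩ hΦ.1 hΦ.leftInvOn
  rwa [hΦ.2.image_eq] at this

/-- The germ `s ↦ 1/Φ(1/s)` is open at zero, so every large `w` is the value of `Φ` at a large
point, and the inverse returns that point. -/
theorem tendsto_inverse_cobounded (hΦ : IsConformalOntoExterior Φ Ω) (hΩ : IsOpen Ω) {M : ℝ}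
    (hM : 0 < M) (hMΩ : {z : ℂ | M < ‖z‖} ⊆ Ω) :
    Tendsto (exteriorInverse Φ Ω) (Bornology.cobounded ℂ) (Bornology.cobounded ℂ) := by
  obtain ⟨g, hg, hg0, hgf⟩ := exists_analyticAt_inv_of_tendsto_cobounded (hΦ.1.mono hMΩ)
    (hΦ.tendsto_cobounded hΩ hM hMΩ)
  have hMne : ∀ᶠ s in 𝓝[≠] (0 : ℂ), M < ‖s⁻¹‖ :=
    tendsto_norm_inv_nhdsNE_zero_atTop.eventually (eventually_gt_atTop M)
  have hopen : 𝓝 (g 0) ≤ map g (𝓝 0) := by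
    refine hg.eventually_constant_or_nhds_le_map_nhds.resolve_left fun h => ?_
    obtain ⟨s, ⟨h1, h2⟩, h3⟩ :=
      ((hMne.and (h.filter_mono nhdsWithin_le_nhds)).and self_mem_nhdsWithin).exists
    have h4 : 1 < ‖Φ s⁻¹‖ := hΦ.2.mapsTo (hMΩ h1)
    rw [hg0, hgf s h3, inv_eq_zero] at h2
    rw [h2, norm_zero] at h4
    linarith
  rw [hg0] at hopen
  rw [← tendsto_norm_atTop_iff_cobounded, tendsto_atTop]
  intro C
  have hC : ∀ᶠ s in 𝓝[≠] (0 : ℂ), C ≤ ‖s⁻¹‖ :=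
    tendsto_norm_inv_nhdsNE_zero_atTop.eventually (eventually_ge_atTop C)
  have hB := eventually_nhdsWithin_iff.1 (hMne.and hC)
  have h5 := tendsto_inv₀_cobounded.eventually (hopen (image_mem_map hB))
  filter_upwards [h5, Bornology.eventually_ne_cobounded 0] with w hw hw0
  obtain ⟨s, hs, hsw⟩ := hw
  have hs0 : s ≠ 0 := by
    rintro rfl
    rw [hg0] at hsw
    exact inv_ne_zero hw0 hsw.symm
  rw [hgf s hs0, inv_inj] at hsw
  rw [← hsw, hΦ.leftInvOn (hMΩ (hs hs0).1)]
  exact (hs hs0).2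

/-- In the charts at infinity `Φ` and its inverse become germs `g` and `k` with `g ∘ k = id`. Hence
`k'(0) ≠ 0`, the pole of the inverse is simple, and `c = 1/k'(0)`. -/
theorem exists_tendsto_inverse_div (hΦ : IsConformalOntoExterior Φ Ω) (hΩ : IsOpen Ω) {M : ℝ}
    (hM : 0 < M) (hMΩ : {z : ℂ | M < ‖z‖} ⊆ Ω) :
    ∃ c : ℂ, c ≠ 0 ∧ Tendsto (fun w => exteriorInverse Φ Ω w / w) (Bornology.cobounded ℂ) (𝓝 c) := by
  obtain ⟨g, hg, hg0, hgf⟩ := exists_analyticAt_inv_of_tendsto_cobounded (hΦ.1.mono hMΩ)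
    (hΦ.tendsto_cobounded hΩ hM hMΩ)
  have hlim := hΦ.tendsto_inverse_cobounded hΩ hM hMΩ
  obtain ⟨k, hk, hk0, hkf⟩ := exists_analyticAt_inv_of_tendsto_cobounded
    (hΦ.differentiableOn_inverse hΩ) hlim
  have hlarge : ∀ᶠ s in 𝓝[≠] (0 : ℂ), 1 < ‖s⁻¹‖ :=
    tendsto_norm_inv_nhdsNE_zero_atTop.eventually (eventually_gt_atTop 1)
  have hΨ0 : ∀ᶠ s in 𝓝[≠] (0 : ℂ), exteriorInverse Φ Ω s⁻¹ ≠ 0 :=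
    (hlim.comp tendsto_inv₀_nhdsNE_zero).eventually (Bornology.eventually_ne_cobounded 0)
  have hcomp : ∀ᶠ s in 𝓝 (0 : ℂ), g (k s) = s := by
    have h := eventually_nhdsWithin_iff.1 (hlarge.and hΨ0)
    filter_upwards [h] with s hs
    rcases eq_or_ne s 0 with rfl | h0
    · rw [hk0, hg0]
    · rw [hkf s h0, hgf _ (inv_ne_zero (hs h0).2), inv_inv, hΦ.apply_inverse (hs h0).1, inv_inv]
  have hkd := hk.differentiableAt.hasDerivAt
  have hk' : deriv k 0 ≠ 0 := by
    intro h0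
    have hgd : HasDerivAt g (deriv g (k 0)) (k 0) := by
      rw [hk0]; exact hg.differentiableAt.hasDerivAt
    have h1 := hgd.comp 0 hkd
    have h2 := (hasDerivAt_id (0 : ℂ)).congr_of_eventuallyEq hcomp
    simpa [h0] using h1.unique h2
  refine ⟨(deriv k 0)⁻¹, inv_ne_zero hk', ?_⟩
  have h6 := ((hasDerivAt_iff_tendsto_slope.1 hkd).comp tendsto_inv₀_cobounded').inv₀ hk'
  refine h6.congr' ?_
  filter_upwards [Bornology.eventually_ne_cobounded 0] with w hw
  simp [slope_def_field, hk0, hkf _ (inv_ne_zero hw), div_eq_mul_inv, mul_comm]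

end IsConformalOntoExterior

/-! ### Cauchy integrals on annuli and reflection across the unit circle -/

theorem isOpen_annulus (a b : ℝ) : IsOpen {w : ℂ | a < ‖w‖ ∧ ‖w‖ < b} :=
  (isOpen_lt continuous_const continuous_norm).inter (isOpen_lt continuous_norm continuous_const)

theorem isPreconnected_annulus {a b : ℝ} (ha : 0 ≤ a) :
    IsPreconnected {w : ℂ | a < ‖w‖ ∧ ‖w‖ < b} :=
  isPreconnected_norm_preimage (S := Set.Ioo a b) isPreconnected_Ioo fun _ hx => ha.trans hx.1.le

theorem circleIntegral_eq_of_differentiableOn_annulus {h : ℂ → ℂ} {a b s R : ℝ} (ha : 0 ≤ a)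
    (has : a < s) (hsR : s ≤ R) (hRb : R < b)
    (hh : DifferentiableOn ℂ h {w | a < ‖w‖ ∧ ‖w‖ < b}) :
    (∮ w in C(0, R), h w) = ∮ w in C(0, s), h w := by
  refine Complex.circleIntegral_eq_of_differentiable_on_annulus_off_countable (ha.trans_lt has) hsR
    Set.countable_empty (hh.continuousOn.mono ?_) fun z hz => ?_
  · rintro w ⟨h1, h2⟩
    simp only [Metric.mem_closedBall, Metric.mem_ball, dist_zero_right, not_lt] at h1 h2
    exact ⟨has.trans_le h2, h1.trans_lt hRb⟩
  · obtain ⟨⟨h1, h2⟩, -⟩ := hz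
    simp only [Metric.mem_closedBall, Metric.mem_ball, dist_zero_right, not_le] at h1 h2
    exact hh.differentiableAt ((isOpen_annulus a b).mem_nhds ⟨has.trans h2, h1.trans hRb⟩)

/-- The Cauchy transform of `f` on the circle of radius `R` around the origin. -/
noncomputable def cauchyTransform (R : ℝ) (f : ℂ → ℂ) (w : ℂ) : ℂ :=
  (2 * Real.pi * Complex.I : ℂ)⁻¹ • ∮ ζ in C(0, R), (ζ - w)⁻¹ • f ζ

theorem differentiableOn_cauchyTransform {R : ℝ} (hR : 0 < R) {f : ℂ → ℂ}
    (hf : ContinuousOn f (Metric.sphere 0 R)) :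
    DifferentiableOn ℂ (cauchyTransform R f) (Metric.ball 0 R) := by
  lift R to NNReal using hR.le
  have h := hasFPowerSeriesOn_cauchy_integral (hf.circleIntegrable hR.le) (by exact_mod_cast hR)
  have h2 := h.differentiableOn
  rwa [Metric.eball_coe] at h2

theorem sphere_subset_annulus {a b R : ℝ} (h1 : a < R) (h2 : R < b) :
    Metric.sphere (0 : ℂ) R ⊆ {w | a < ‖w‖ ∧ ‖w‖ < b} := fun w hw => by
  have : ‖w‖ = R := by simpa using hw
  exact ⟨by rw [this]; exact h1, by rw [this]; exact h2⟩

/-- The pole `w` lies inside both circles, so Cauchy's theorem applies on the annulus with inner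
radius `max a ‖w‖`. -/
theorem cauchyTransform_eq_of_annulus {f : ℂ → ℂ} {a b s R : ℝ} (ha : 0 ≤ a)
    (has : a < s) (hsR : s ≤ R) (hRb : R < b)
    (hf : DifferentiableOn ℂ f {w | a < ‖w‖ ∧ ‖w‖ < b}) {w : ℂ} (hw : ‖w‖ < s) :
    cauchyTransform R f w = cauchyTransform s f w := by
  unfold cauchyTransform
  congr 1
  refine circleIntegral_eq_of_differentiableOn_annulus (a := max a ‖w‖) (b := b)
    (ha.trans (le_max_left _ _)) (max_lt has hw) hsR hRb ?_
  intro ζ hζ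
  obtain ⟨h1, h2⟩ := hζ
  have hne : ζ - w ≠ 0 := by
    rw [sub_ne_zero]; rintro rfl; exact (le_max_right a ‖ζ‖).not_gt h1
  refine ((differentiableWithinAt_id.sub_const w).inv hne).smul
    ((hf ζ ⟨(le_max_left _ _).trans_lt h1, h2⟩).mono fun x hx =>
      ⟨(le_max_left _ _).trans_lt hx.1, hx.2⟩)

theorem circleIntegral_sub_inv_eq_zero {s : ℝ} (hs : 0 ≤ s) {w : ℂ} (hw : s < ‖w‖) :
    (∮ ζ in C(0, s), (ζ - w)⁻¹) = 0 := by
  refine DiffContOnCl.circleIntegral_eq_zero hs (DifferentiableOn.diffContOnCl ?_)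
  intro ζ hζ
  refine ((differentiableWithinAt_id.sub_const w).inv ?_)
  have h1 : ‖ζ‖ ≤ s := by simpa using Metric.closure_ball_subset_closedBall hζ
  simp only [id, sub_ne_zero]
  rintro rfl
  exact hw.not_ge h1

/-- The Cauchy integral formula for an annulus. -/
theorem cauchyTransform_sub_cauchyTransform {f : ℂ → ℂ} {a b s R : ℝ} (ha : 0 ≤ a)
    (has : a < s) (hRb : R < b)
    (hf : DifferentiableOn ℂ f {w | a < ‖w‖ ∧ ‖w‖ < b}) {w : ℂ} (hw : s < ‖w‖) (hwR : ‖w‖ < R) :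
    cauchyTransform R f w - cauchyTransform s f w = f w := by
  have hA := (isOpen_annulus a b).mem_nhds (x := w) ⟨has.trans hw, hwR.trans hRb⟩
  -- The difference quotient at `w` has no pole, so its integrals over the two circles agree.
  -- Splitting it leaves `f w` times the winding numbers about `w`, one for the outer circle and
  -- zero for the inner.
  have hd := (Complex.differentiableOn_dslope hA).2 hf
  have heq := circleIntegral_eq_of_differentiableOn_annulus ha has (hw.trans hwR).le hRb hd
  have hs0 : 0 < s := ha.trans_lt has
  have key : ∀ t : ℝ, a < t → t < b → t ≠ ‖w‖ → (∮ ζ in C(0, t), dslope f w ζ) =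
      (∮ ζ in C(0, t), (ζ - w)⁻¹ • f ζ) - (∮ ζ in C(0, t), (ζ - w)⁻¹) * f w := by
    intro t h1 h2 h3
    have ht : 0 < t := ha.trans_lt h1
    have hne : ∀ ζ ∈ Metric.sphere (0 : ℂ) t, ζ ≠ w := by
      rintro ζ hζ rfl
      simp at hζ
      exact h3 hζ.symm
    have hc1 : ContinuousOn (fun ζ : ℂ => (ζ - w)⁻¹) (Metric.sphere 0 t) := fun ζ hζ =>
      ((continuousAt_id.sub continuousAt_const).inv₀
        (sub_ne_zero.2 (hne ζ hζ))).continuousWithinAt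
    have hc2 := hf.continuousOn.mono (sphere_subset_annulus h1 h2)
    rw [mul_comm, ← circleIntegral.integral_const_mul, ← circleIntegral.integral_sub
      ((hc1.fun_smul hc2).circleIntegrable ht.le)
      ((continuousOn_const.fun_mul hc1).circleIntegrable ht.le)]
    refine circleIntegral.integral_congr ht.le fun ζ hζ => ?_
    rw [dslope_of_ne _ (hne ζ hζ), slope_def_field, smul_eq_mul]
    ring
  rw [key R (has.trans (hw.trans hwR)) hRb hwR.ne', key s has (hw.trans (hwR.trans hRb)) hw.ne,
    circleIntegral_sub_inv_eq_zero hs0.le hw,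
    circleIntegral.integral_sub_inv_of_mem_ball (by simpa using hwR)] at heq
  unfold cauchyTransform
  rw [← smul_sub, smul_eq_mul, inv_mul_eq_iff_eq_mul₀ Complex.two_pi_I_ne_zero]
  linear_combination heq

/-- On the circle `dζ = iζ dθ`, so `dζ / (2πiζ)` is real and survives conjugation. -/
theorem conj_circleIntegral {s : ℝ} (hs : 0 < s) (f : ℂ → ℂ) :
    (starRingEnd ℂ) ((2 * Real.pi * Complex.I : ℂ)⁻¹ • ∮ ζ in C(0, s), f ζ) =
      (2 * Real.pi * Complex.I : ℂ)⁻¹ • ∮ ζ in C(0, s), ζ⁻¹ * (starRingEnd ℂ) (ζ * f ζ) := by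
  simp only [circleIntegral, smul_eq_mul, map_mul, ← intervalIntegral.intervalIntegral_conj]
  simp only [map_inv₀, map_mul, Complex.conj_I, Complex.conj_ofReal, map_ofNat, deriv_circleMap]
  rw [← intervalIntegral.integral_const_mul, ← intervalIntegral.integral_const_mul]
  congr 1
  ext θ
  have : circleMap 0 s θ ≠ 0 := by simp [circleMap, hs.ne']
  have hpi : (Real.pi : ℂ) ≠ 0 := by exact_mod_cast Real.pi_ne_zero
  have hI := Complex.I_ne_zero
  field_simp

/-- On the circle `conj ζ = s² / ζ`. This turns the kernel at the outer point `w` into the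
difference of the kernels at `0` and at the reflected point `s² / conj w`. -/
theorem cauchyTransform_conj {G : ℂ → ℂ} {s : ℝ} (hs : 0 < s)
    (hG : ContinuousOn G (Metric.sphere 0 s)) {w : ℂ} (hw : s < ‖w‖) :
    cauchyTransform s (fun ζ => (starRingEnd ℂ) (G ζ)) w =
      (starRingEnd ℂ) (cauchyTransform s G 0 - cauchyTransform s G (s ^ 2 / (starRingEnd ℂ) w)) := by
  have hw0 : w ≠ 0 := norm_pos_iff.1 (hs.trans hw)
  have hcw : (starRingEnd ℂ) w ≠ 0 := by simpa using hw0
  set v : ℂ := s ^ 2 / (starRingEnd ℂ) w with hv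
  have hvn : ‖v‖ < s := by
    rw [hv, norm_div, RCLike.norm_conj, norm_pow, Complex.norm_real, Real.norm_of_nonneg hs.le,
      div_lt_iff₀ (hs.trans hw)]
    nlinarith
  rw [← Complex.conj_conj (cauchyTransform s (fun ζ => (starRingEnd ℂ) (G ζ)) w)]
  congr 1
  unfold cauchyTransform
  rw [conj_circleIntegral hs, ← smul_sub]
  congr 1
  have hc : ∀ u : ℂ, ‖u‖ < s → CircleIntegrable (fun ζ => (ζ - u)⁻¹ • G ζ) 0 s := fun u hu => by
    refine ContinuousOn.circleIntegrable hs.le (ContinuousOn.fun_smul (fun ζ hζ => ?_) hG)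
    refine ((continuousAt_id.sub continuousAt_const).inv₀ (sub_ne_zero.2 ?_)).continuousWithinAt
    rintro rfl
    simp at hζ hu
    exact hu.ne hζ
  rw [← circleIntegral.integral_sub (hc 0 (by simpa using hs)) (hc v hvn)]
  refine circleIntegral.integral_congr hs.le fun ζ hζ => ?_
  have hζn : ‖ζ‖ = s := by simpa using hζ
  have hζ0 : ζ ≠ 0 := norm_pos_iff.1 (hζn ▸ hs)
  have h1 : ζ - w ≠ 0 := sub_ne_zero.2 (by rintro rfl; exact hw.ne' hζn)
  have h2 : ζ - v ≠ 0 := sub_ne_zero.2 (by rintro h; rw [← h] at hvn; exact hvn.ne hζn)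
  have h3 : (starRingEnd ℂ) ζ = s ^ 2 / ζ := by
    rw [eq_div_iff hζ0, mul_comm, Complex.mul_conj, Complex.normSq_eq_norm_sq, hζn]; norm_cast
  have h4 : (starRingEnd ℂ) ζ - (starRingEnd ℂ) w ≠ 0 := by
    rw [← map_sub]; exact (map_ne_zero _).2 h1
  simp only [smul_eq_mul, map_mul, map_inv₀, map_sub, Complex.conj_conj, sub_zero]
  have h5 : (starRingEnd ℂ) w * v = s ^ 2 := by rw [hv]; field_simp
  have h6 : (starRingEnd ℂ) ζ * ζ = s ^ 2 := by rw [h3]; field_simp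
  clear_value v
  field_simp
  linear_combination (G ζ) * (h6 - h5)

theorem norm_sub_conj_inv {t : ℂ} (ht : t ≠ 0) :
    ‖t - (starRingEnd ℂ) t⁻¹‖ = |‖t‖ - ‖t‖⁻¹| := by
  have hn : (‖t‖ : ℂ) ≠ 0 := by exact_mod_cast norm_ne_zero_iff.2 ht
  have hc : (starRingEnd ℂ) t ≠ 0 := (map_ne_zero _).2 ht
  have h : t - (starRingEnd ℂ) t⁻¹ = t / ‖t‖ * ((‖t‖ - ‖t‖⁻¹ : ℝ) : ℂ) := by
    have h2 : t * (starRingEnd ℂ) t = (‖t‖ : ℂ) ^ 2 := by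
      rw [Complex.mul_conj, Complex.normSq_eq_norm_sq]; norm_cast
    rw [map_inv₀]
    push_cast
    field_simp
    linear_combination h2
  rw [h, norm_mul, norm_div, Complex.norm_real, Complex.norm_real, norm_norm,
    div_self (norm_ne_zero_iff.2 ht), one_mul, Real.norm_eq_abs]

theorem abs_sub_inv_le {t ε : ℝ} (hε : ε ≤ 1 / 2) (ht : |t - 1| < ε) : |t - t⁻¹| ≤ 5 * ε := by
  obtain ⟨h1, h2⟩ := abs_lt.1 ht
  have ht0 : 0 < t := by linarith
  have h : t - t⁻¹ = (t - 1) * ((t + 1) / t) := by field_simp; ring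
  rw [h, abs_mul]
  have h3 : |(t + 1) / t| ≤ 5 := by
    rw [abs_of_pos (by positivity), div_le_iff₀ ht0]; linarith
  calc |t - 1| * |(t + 1) / t| ≤ ε * 5 :=
        mul_le_mul ht.le h3 (abs_nonneg _) ((abs_nonneg _).trans ht.le)
    _ = 5 * ε := by ring

/-- Reflection principle across the unit circle, for a holomorphic function on an outer collar whose
modulus tends to one at the circle. -/
theorem exists_holomorphic_extension_of_norm_tendsto_one {T : ℂ → ℂ} {R b : ℝ} (hR : 1 < R)
    (hRb : R < b) (hT : DifferentiableOn ℂ T {w | 1 < ‖w‖ ∧ ‖w‖ < b})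
    (hT0 : ∀ w, 1 < ‖w‖ → ‖w‖ < b → T w ≠ 0)
    (hlim : ∀ ε > 0, ∃ ρ > 1, ∀ w, 1 < ‖w‖ → ‖w‖ < ρ → |‖T w‖ - 1| < ε) :
    ∃ S : ℂ → ℂ, DifferentiableOn ℂ S {w | R⁻¹ < ‖w‖ ∧ ‖w‖ < R} ∧
      ∀ w, 1 < ‖w‖ → ‖w‖ < R → S w = T w := by
  have hR0 : 0 < R := by linarith
  set G : ℂ → ℂ := fun w => (T w)⁻¹ with hGdef
  have hG : DifferentiableOn ℂ G {w | 1 < ‖w‖ ∧ ‖w‖ < b} := fun w hw =>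
    (hT w hw).inv (hT0 w hw.1 hw.2)
  have hCT := differentiableOn_cauchyTransform hR0
    (hT.continuousOn.mono (sphere_subset_annulus hR hRb))
  have hCG := differentiableOn_cauchyTransform hR0
    (hG.continuousOn.mono (sphere_subset_annulus hR hRb))
  -- Cauchy's formula for `T` on `s < |w| < R` has an inner-circle term. As `s ↓ 1`, `|T| → 1`
  -- allows `T` to be replaced there by `conj (1/T)`, whose transform is expressed through an
  -- integral of `1/T` over the outer circle and is holomorphic across `|w| = 1`.
  refine ⟨fun w => cauchyTransform R T w - (starRingEnd ℂ) (cauchyTransform R G 0 -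
    cauchyTransform R G ((starRingEnd ℂ) w⁻¹)), ?_, ?_⟩
  · rintro w ⟨h1, h2⟩
    have hw0 : w ≠ 0 := norm_pos_iff.1 ((inv_pos.2 hR0).trans h1)
    have hA : DifferentiableAt ℂ (cauchyTransform R T) w :=
      hCT.differentiableAt (Metric.isOpen_ball.mem_nhds (by simpa using h2))
    have hB : DifferentiableAt ℂ (cauchyTransform R G) ((starRingEnd ℂ) w⁻¹) :=
      hCG.differentiableAt (Metric.isOpen_ball.mem_nhds (by
        rw [mem_ball_zero_iff, RCLike.norm_conj, norm_inv]
        exact inv_lt_of_inv_lt₀ hR0 h1))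
    have hB2 := hB.conj_conj
    rw [Complex.conj_conj] at hB2
    have hB3 := DifferentiableAt.comp (f := fun x : ℂ => x⁻¹) w hB2 (differentiableAt_inv hw0)
    have hall := hA.sub ((differentiableAt_const
      ((starRingEnd ℂ) (cauchyTransform R G 0))).sub hB3)
    refine (hall.congr_of_eventuallyEq (Eventually.of_forall fun x => ?_)).differentiableWithinAt
    simp [Function.comp]
  · intro w h1 h2
    have hw0 : w ≠ 0 := norm_pos_iff.1 (one_pos.trans h1)
    set D : ℝ → ℂ := fun s => cauchyTransform R T w - (starRingEnd ℂ) (cauchyTransform R G 0 -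
      cauchyTransform R G (s ^ 2 / (starRingEnd ℂ) w)) with hD
    have hlim1 : Tendsto D (𝓝[>] 1) (𝓝 (cauchyTransform R T w - (starRingEnd ℂ)
        (cauchyTransform R G 0 - cauchyTransform R G ((starRingEnd ℂ) w⁻¹)))) := by
      have hc : Tendsto (fun s : ℝ => (s : ℂ) ^ 2 / (starRingEnd ℂ) w) (𝓝 1)
          (𝓝 ((starRingEnd ℂ) w⁻¹)) := by
        have : Continuous fun s : ℝ => (s : ℂ) ^ 2 / (starRingEnd ℂ) w := by fun_prop
        simpa using this.tendsto 1
      have hB : ContinuousAt (cauchyTransform R G) ((starRingEnd ℂ) w⁻¹) :=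
        (hCG.differentiableAt (Metric.isOpen_ball.mem_nhds (by
          rw [mem_ball_zero_iff, RCLike.norm_conj, norm_inv]
          exact (inv_lt_one_of_one_lt₀ h1).trans hR))).continuousAt
      have h3 := (hB.tendsto.comp hc).mono_left (nhdsWithin_le_nhds (s := Set.Ioi 1))
      exact tendsto_const_nhds.sub ((Complex.continuous_conj.tendsto _).comp
        (tendsto_const_nhds.sub h3))
    refine tendsto_nhds_unique hlim1 ?_
    rw [Metric.tendsto_nhds]
    intro δ hδ
    set m : ℝ := (1 + ‖w‖) / 2 with hm
    have hm1 : 1 < m := by rw [hm]; linarith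
    have hmw : m < ‖w‖ := by rw [hm]; linarith
    -- The kernel is at most `1 / (‖w‖ - m)` and `abs_sub_inv_le` costs a factor `5`; with this
    -- choice the error is at most `δ / 2`.
    set ε : ℝ := min (1 / 2) (δ * (‖w‖ - m) / (10 * m)) with hε
    have hε0 : 0 < ε := lt_min (by norm_num)
      (div_pos (mul_pos hδ (by linarith)) (by linarith))
    obtain ⟨ρ, hρ, hρT⟩ := hlim ε hε0
    filter_upwards [Ioo_mem_nhdsGT (lt_min hm1 hρ)] with s hs
    obtain ⟨hs1, hs2⟩ := hs
    have hsm : s < m := hs2.trans_le (min_le_left _ _)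
    have hsρ : s < ρ := hs2.trans_le (min_le_right _ _)
    have hs0 : 0 < s := by linarith
    have hsw : s < ‖w‖ := hsm.trans hmw
    have hsb : s < b := by linarith
    have hcT := hT.continuousOn.mono (sphere_subset_annulus hs1 hsb)
    have hcG := hG.continuousOn.mono (sphere_subset_annulus hs1 hsb)
    have hsR : s ≤ R := (hsw.trans h2).le
    have hvn : ‖(s : ℂ) ^ 2 / (starRingEnd ℂ) w‖ < s := by
      rw [norm_div, RCLike.norm_conj, norm_pow, Complex.norm_real, Real.norm_of_nonneg hs0.le,
        div_lt_iff₀ (hs0.trans hsw)]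
      nlinarith
    have e1 := cauchyTransform_sub_cauchyTransform zero_le_one hs1 hRb hT hsw h2
    have e2 := cauchyTransform_conj hs0 hcG hsw
    rw [← cauchyTransform_eq_of_annulus zero_le_one hs1 hsR hRb hG hvn,
      ← cauchyTransform_eq_of_annulus zero_le_one hs1 hsR hRb hG (w := 0) (by simpa using hs0)] at e2
    have e3 : D s - T w = cauchyTransform s (fun ζ => T ζ - (starRingEnd ℂ) (G ζ)) w := by
      rw [← e1, hD]
      simp only
      rw [← e2]
      unfold cauchyTransform
      have hci : ContinuousOn (fun ζ : ℂ => (ζ - w)⁻¹) (Metric.sphere 0 s) := fun ζ hζ => by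
        refine ((continuousAt_id.sub continuousAt_const).inv₀
          (sub_ne_zero.2 ?_)).continuousWithinAt
        rintro rfl
        simp at hζ
        exact hsw.ne' hζ
      have hcG' : ContinuousOn (fun ζ => (starRingEnd ℂ) (G ζ)) (Metric.sphere 0 s) :=
        Complex.continuous_conj.comp_continuousOn hcG
      have : (∮ ζ in C(0, s), (ζ - w)⁻¹ • (T ζ - (starRingEnd ℂ) (G ζ))) =
          (∮ ζ in C(0, s), (ζ - w)⁻¹ • T ζ) -
            ∮ ζ in C(0, s), (ζ - w)⁻¹ • (starRingEnd ℂ) (G ζ) := by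
        rw [← circleIntegral.integral_sub ((hci.fun_smul hcT).circleIntegrable hs0.le)
          ((hci.fun_smul hcG').circleIntegrable hs0.le)]
        refine circleIntegral.integral_congr hs0.le fun ζ _ => ?_
        simp [mul_sub]
      rw [this, smul_sub]
      ring
    rw [dist_eq_norm, e3]
    have hbound : ∀ ζ ∈ Metric.sphere (0 : ℂ) s,
        ‖(ζ - w)⁻¹ • (T ζ - (starRingEnd ℂ) (G ζ))‖ ≤ (‖w‖ - m)⁻¹ * (5 * ε) := by
      intro ζ hζ
      have hζn : ‖ζ‖ = s := by simpa using hζ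
      rw [norm_smul, norm_inv]
      have h3 : ‖w‖ - m ≤ ‖ζ - w‖ := by
        have := norm_sub_norm_le w ζ
        rw [norm_sub_rev] at this
        linarith
      have hTζ := hT0 ζ (by rw [hζn]; exact hs1) (by rw [hζn]; exact hsb)
      have h4 : ‖T ζ - (starRingEnd ℂ) (G ζ)‖ ≤ 5 * ε := by
        rw [hGdef]; simp only; rw [norm_sub_conj_inv hTζ]
        exact abs_sub_inv_le (min_le_left _ _)
          (hρT ζ (by rw [hζn]; exact hs1) (by rw [hζn]; exact hsρ))
      exact mul_le_mul (inv_anti₀ (by linarith) h3) h4 (norm_nonneg _)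
        (inv_nonneg.2 (by linarith))
    have h5 := circleIntegral.norm_two_pi_i_inv_smul_integral_le_of_norm_le_const hs0.le hbound
    refine h5.trans_lt ?_
    have h6 : ε ≤ δ * (‖w‖ - m) / (10 * m) := min_le_right _ _
    have hwm : 0 < ‖w‖ - m := by linarith
    calc s * ((‖w‖ - m)⁻¹ * (5 * ε)) ≤ m * ((‖w‖ - m)⁻¹ * (5 * (δ * (‖w‖ - m) / (10 * m)))) := by
          gcongr
      _ = δ / 2 := by have : m ≠ 0 := by linarith
                      field_simp
                      norm_num
      _ < δ := by linarith

theorem frequently_norm_eq_one {b : ℂ} (hb : ‖b‖ = 1) : ∃ᶠ w in 𝓝[≠] b, ‖w‖ = 1 := by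
  have hb0 : b ≠ 0 := norm_pos_iff.1 (by rw [hb]; exact one_pos)
  have ht : Tendsto (fun t : ℝ => Complex.exp (t * Complex.I) * b) (𝓝[>] 0) (𝓝[≠] b) := by
    refine tendsto_nhdsWithin_iff.2 ⟨?_, ?_⟩
    · have : Continuous fun t : ℝ => Complex.exp (t * Complex.I) * b := by fun_prop
      simpa using (this.tendsto 0).mono_left nhdsWithin_le_nhds
    · filter_upwards [Ioo_mem_nhdsGT Real.pi_pos] with t ht h
      have h2 : Complex.exp (t * Complex.I) * b = b := h
      have h3 := congrArg Complex.im ((mul_eq_right₀ hb0).1 h2)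
      rw [Complex.exp_ofReal_mul_I_im] at h3
      exact (Real.sin_pos_of_mem_Ioo ht).ne' (by simpa using h3)
  refine ht.frequently (Eventually.frequently (Eventually.of_forall fun t => ?_))
  rw [norm_mul, Complex.norm_exp_ofReal_mul_I, one_mul, hb]

theorem norm_inv_conj (w : ℂ) : ‖((starRingEnd ℂ) w)⁻¹‖ = ‖w‖⁻¹ := by
  rw [norm_inv, RCLike.norm_conj]

/-- Reflection principle across the unit circle for an injective map of outer collars. -/
theorem exists_reflection {T : ℂ → ℂ} {R b : ℝ} (hR : 1 < R)
    (hRb : R < b) (hT : DifferentiableOn ℂ T {w | 1 < ‖w‖ ∧ ‖w‖ < b})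
    (hT1 : ∀ w, 1 < ‖w‖ → ‖w‖ < b → 1 < ‖T w‖)
    (hinj : Set.InjOn T {w | 1 < ‖w‖ ∧ ‖w‖ < b})
    (hlim : ∀ ε > 0, ∃ ρ > 1, ∀ w, 1 < ‖w‖ → ‖w‖ < ρ → |‖T w‖ - 1| < ε) :
    ∃ S : ℂ → ℂ, DifferentiableOn ℂ S {w | R⁻¹ < ‖w‖ ∧ ‖w‖ < R} ∧
      (∀ w, 1 < ‖w‖ → ‖w‖ < R → S w = T w) ∧ (∀ w, ‖w‖ = 1 → ‖S w‖ = 1) ∧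
      (∀ w, R⁻¹ < ‖w‖ → ‖w‖ < R → ‖S w‖ * ‖S ((starRingEnd ℂ) w)⁻¹‖ = 1) ∧
      Set.InjOn S {w | ‖w‖ = 1} := by
  have hR0 : 0 < R := by linarith
  have hRi : R⁻¹ < 1 := inv_lt_one_of_one_lt₀ hR
  obtain ⟨S, hS, hST⟩ := exists_holomorphic_extension_of_norm_tendsto_one hR hRb hT
    (fun w h1 h2 => norm_pos_iff.1 (one_pos.trans (hT1 w h1 h2))) hlim
  have hSd : ∀ w, R⁻¹ < ‖w‖ → ‖w‖ < R → DifferentiableAt ℂ S w := fun w h1 h2 =>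
    hS.differentiableAt ((isOpen_annulus _ _).mem_nhds ⟨h1, h2⟩)
  have hcirc : ∀ w, ‖w‖ = 1 → ‖S w‖ = 1 := by
    intro w hw
    have hcont := (hSd w (by rw [hw]; exact hRi) (by rw [hw]; exact hR)).continuousAt.norm
    by_contra hne
    set ε := |‖S w‖ - 1| with hε
    have hε0 : 0 < ε := abs_pos.2 (sub_ne_zero.2 hne)
    obtain ⟨ρ, hρ, hρT⟩ := hlim (ε / 2) (by positivity)
    have h1 : ∀ᶠ x in 𝓝 w, |‖S x‖ - 1| > ε / 2 := by
      have : Tendsto (fun x => |‖S x‖ - 1|) (𝓝 w) (𝓝 ε) := (hcont.tendsto.sub_const 1).abs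
      exact this.eventually (lt_mem_nhds (by linarith))
    have h2 : ∀ᶠ x in 𝓝 w, ‖x‖ < min ρ R :=
      continuous_norm.continuousAt.eventually (gt_mem_nhds (hw.trans_lt (lt_min hρ hR)))
    obtain ⟨x, hx1, hx2, hx3⟩ := ((frequently_norm_gt hw.ge one_pos).and_eventually
      (h1.and h2)).exists
    rw [hST x hx1 (hx3.trans_le (min_le_right _ _))] at hx2
    exact (hρT x hx1 (hx3.trans_le (min_le_left _ _))).not_gt hx2
  -- The two conjugations cancel, so the product is holomorphic. On the unit circle, fixed by the
  -- reflection, it is `|S|² = 1`, and the identity theorem applies.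
  have hrefl : ∀ w, R⁻¹ < ‖w‖ → ‖w‖ < R →
      S w * (starRingEnd ℂ) (S ((starRingEnd ℂ) w)⁻¹) = 1 := by
    have hP : DifferentiableOn ℂ (fun w => S w * (starRingEnd ℂ) (S ((starRingEnd ℂ) w)⁻¹))
        {w | R⁻¹ < ‖w‖ ∧ ‖w‖ < R} := by
      rintro w ⟨h1, h2⟩
      have hw0 : w ≠ 0 := norm_pos_iff.1 ((inv_pos.2 hR0).trans h1)
      have hB : DifferentiableAt ℂ S ((starRingEnd ℂ) w⁻¹) := hSd _
        (by rw [RCLike.norm_conj, norm_inv]; exact inv_strictAnti₀ (norm_pos_iff.2 hw0) h2)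
        (by rw [RCLike.norm_conj, norm_inv]; exact inv_lt_of_inv_lt₀ hR0 h1)
      have hB2 := hB.conj_conj
      rw [Complex.conj_conj] at hB2
      have hB3 := DifferentiableAt.comp (f := fun x : ℂ => x⁻¹) w hB2 (differentiableAt_inv hw0)
      refine (((hSd w h1 h2).mul hB3).congr_of_eventuallyEq
        (Eventually.of_forall fun x => ?_)).differentiableWithinAt
      simp [Function.comp]
    have hconn := isPreconnected_annulus (a := R⁻¹) (b := R) (inv_nonneg.2 hR0.le)
    have h1mem : (1 : ℂ) ∈ {w : ℂ | R⁻¹ < ‖w‖ ∧ ‖w‖ < R} := ⟨by simpa using hRi, by simpa using hR⟩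
    have hfreq : ∃ᶠ w in 𝓝[≠] (1 : ℂ),
        S w * (starRingEnd ℂ) (S ((starRingEnd ℂ) w)⁻¹) = 1 := by
      refine (frequently_norm_eq_one norm_one).mono fun w hwn => ?_
      have : ((starRingEnd ℂ) w)⁻¹ = w := by
        have h := Complex.mul_conj w
        rw [Complex.normSq_eq_norm_sq, hwn] at h
        exact inv_eq_of_mul_eq_one_left (by simpa using h)
      rw [this, Complex.mul_conj, Complex.normSq_eq_norm_sq, hcirc w hwn]
      simp
    have := (hP.analyticOnNhd (isOpen_annulus _ _)).eqOn_of_preconnected_of_frequently_eq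
      (analyticOnNhd_const (v := (1 : ℂ))) hconn h1mem hfreq
    exact fun w h1 h2 => this ⟨h1, h2⟩
  have hrefl' : ∀ w, R⁻¹ < ‖w‖ → ‖w‖ < R → ‖S w‖ * ‖S ((starRingEnd ℂ) w)⁻¹‖ = 1 := by
    intro w h1 h2
    have := congrArg norm (hrefl w h1 h2)
    rwa [norm_mul, RCLike.norm_conj, norm_one] at this
  refine ⟨S, hS, hST, hcirc, hrefl', ?_⟩
  have hle : ∀ w, R⁻¹ < ‖w‖ → ‖w‖ ≤ 1 → ‖S w‖ ≤ 1 := by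
    intro w h1 h2
    rcases h2.eq_or_lt with h | h
    · exact (hcirc w h).le
    · have hw0 : 0 < ‖w‖ := (inv_pos.2 hR0).trans h1
      have h3 := hrefl' w h1 (h.trans hR)
      have h4 : 1 < ‖((starRingEnd ℂ) w)⁻¹‖ := by
        rw [norm_inv_conj]; exact (one_lt_inv₀ hw0).2 h
      have h5 : ‖((starRingEnd ℂ) w)⁻¹‖ < R := by
        rw [norm_inv_conj]; exact inv_lt_of_inv_lt₀ hR0 h1
      rw [hST _ h4 h5] at h3
      have h6 := hT1 _ h4 (h5.trans hRb)
      nlinarith [norm_nonneg (S w)]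
  have hopen : ∀ a, ‖a‖ = 1 → 𝓝 (S a) ≤ map S (𝓝 a) := by
    intro a ha
    refine (hS.analyticAt ((isOpen_annulus _ _).mem_nhds
      ⟨by rw [ha]; exact hRi, by rw [ha]; exact hR⟩)).eventually_constant_or_nhds_le_map_nhds
      |>.resolve_left fun h => ?_
    have h2 : ∀ᶠ x in 𝓝 a, ‖x‖ < R :=
      continuous_norm.continuousAt.eventually (gt_mem_nhds (ha.trans_lt hR))
    obtain ⟨x, hx1, hx2, hx3⟩ := ((frequently_norm_gt ha.ge one_pos).and_eventually
      (h.and h2)).exists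
    rw [hST x hx1 hx3] at hx2
    have := hT1 x hx1 (hx3.trans hRb)
    rw [hx2, hcirc a ha] at this
    exact lt_irrefl _ this
  -- If two circle points share an image, disjoint neighbourhoods of them both cover some `y` with
  -- `|y| > 1`. By `hle` the preimages lie outside the unit circle, where `S = T` is injective.
  intro a ha b' hb h
  by_contra hne
  obtain ⟨A, B, hA, hB, haA, hbB, hAB⟩ := t2_separation hne
  have hev : ∀ c : ℂ, ‖c‖ = 1 → ∀ᶠ x in 𝓝 c, R⁻¹ < ‖x‖ ∧ ‖x‖ < R := fun c hc =>
    (isOpen_annulus _ _).mem_nhds ⟨by rw [hc]; exact hRi, by rw [hc]; exact hR⟩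
  have h1 := hopen a ha (image_mem_map (inter_mem (hA.mem_nhds haA) (hev a ha)))
  have h2 := hopen b' hb (image_mem_map (inter_mem (hB.mem_nhds hbB) (hev b' hb)))
  rw [← h] at h2
  obtain ⟨y, hy1, ⟨p, ⟨hpA, hp1, hp2⟩, hpy⟩, ⟨q, ⟨hqB, hq1, hq2⟩, hqy⟩⟩ :=
    ((frequently_norm_gt (hcirc a ha).ge one_pos).and_eventually
      ((eventually_mem_set.2 h1).and (eventually_mem_set.2 h2))).exists
  have hp : 1 < ‖p‖ := by
    by_contra hc
    exact (hle p hp1 (not_lt.1 hc)).not_gt (hpy ▸ hy1)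
  have hq : 1 < ‖q‖ := by
    by_contra hc
    exact (hle q hq1 (not_lt.1 hc)).not_gt (hqy ▸ hy1)
  have hpq : p = q := hinj ⟨hp, hp2.trans hRb⟩ ⟨hq, hq2.trans hRb⟩ (by
    rw [← hST p hp hp2, ← hST q hq hq2, hpy, hqy])
  exact Set.disjoint_left.1 hAB hpA (hpq ▸ hqB)

/-! ### Holomorphic collars of analytic Jordan curves -/

/-- A real analytic function of a real variable is the restriction of a holomorphic function. -/
theorem AnalyticAt.exists_complexification {γ : ℝ → ℂ} {t₀ : ℝ} (h : AnalyticAt ℝ γ t₀) :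
    ∃ g : ℂ → ℂ, AnalyticAt ℂ g t₀ ∧ ∀ᶠ t : ℝ in 𝓝 t₀, g t = γ t := by
  obtain ⟨p, hp⟩ := h
  -- The real Taylor coefficients reused as a complex series; the same coefficient bounds give a
  -- positive radius of convergence.
  set q : FormalMultilinearSeries ℂ ℂ ℂ := FormalMultilinearSeries.ofScalars ℂ p.coeff with hq
  have hcoeff : ∀ n, q.coeff n = p.coeff n := fun n => by
    simp [hq, FormalMultilinearSeries.coeff_ofScalars]
  have hqr : 0 < q.radius := by
    obtain ⟨r, hr0, hr⟩ := ENNReal.lt_iff_exists_nnreal_btwn.1 hp.radius_pos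
    obtain ⟨C, hC, hCb⟩ := p.norm_mul_pow_le_of_lt_radius hr
    refine hr0.trans_le (q.le_radius_of_bound C fun n => ?_)
    rw [hq, FormalMultilinearSeries.ofScalars_norm,
      ← FormalMultilinearSeries.norm_apply_eq_norm_coef]
    exact hCb n
  have hqs := (q.hasFPowerSeriesOnBall hqr).hasFPowerSeriesAt
  refine ⟨fun z => q.sum (z - t₀), ?_, ?_⟩
  · have h1 : AnalyticAt ℂ q.sum ((t₀ : ℂ) - t₀) := by rw [sub_self]; exact hqs.analyticAt
    exact h1.comp (f := fun z : ℂ => z - t₀) (analyticAt_id.sub analyticAt_const)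
  · have h1 := hasFPowerSeriesAt_iff'.1 hp
    have h2 := hasFPowerSeriesAt_iff'.1 hqs
    have ht : Tendsto (fun t : ℝ => (t : ℂ) - t₀) (𝓝 t₀) (𝓝 0) := by
      have : Continuous fun t : ℝ => (t : ℂ) - t₀ := by fun_prop
      simpa using this.tendsto t₀
    filter_upwards [h1, ht.eventually h2] with t e1 e2
    refine e2.unique ?_
    convert e1 using 2 with n
    rw [hcoeff, sub_zero, smul_eq_mul, Complex.real_smul]
    push_cast
    rfl

theorem norm_div_norm_self {z : ℂ} (hz : z ≠ 0) : ‖z / ‖z‖‖ = 1 := by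
  rw [norm_div, Complex.norm_real, norm_norm, div_self (norm_ne_zero_iff.2 hz)]

theorem dist_div_norm_self {z : ℂ} (hz : z ≠ 0) : dist z (z / ‖z‖) = |‖z‖ - 1| := by
  have h : z - z / ‖z‖ = z / ‖z‖ * ((‖z‖ - 1 : ℝ) : ℂ) := by
    have : (‖z‖ : ℂ) ≠ 0 := by exact_mod_cast norm_ne_zero_iff.2 hz
    push_cast
    field_simp
  rw [dist_eq_norm, h, norm_mul, norm_div_norm_self hz, one_mul, Complex.norm_real,
    Real.norm_eq_abs]

/-- A function on the unit circle which locally extends holomorphically does so globally. -/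
theorem exists_holomorphic_of_local_extension {c : ℂ → ℂ}
    (h : ∀ a : ℂ, ‖a‖ = 1 → ∃ P : ℂ → ℂ, AnalyticAt ℂ P a ∧ ∀ᶠ x in 𝓝 a, ‖x‖ = 1 → P x = c x) :
    ∃ δ > 0, δ ≤ 1 ∧ ∃ J : ℂ → ℂ, (∀ z, |‖z‖ - 1| < δ → DifferentiableAt ℂ J z) ∧
      ∀ a, ‖a‖ = 1 → J a = c a := by
  have h' : ∀ a : Metric.sphere (0 : ℂ) 1, ∃ P : ℂ → ℂ, ∃ r > 0,
      DifferentiableOn ℂ P (Metric.ball a r) ∧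
        ∀ x ∈ Metric.ball (a : ℂ) r, ‖x‖ = 1 → P x = c x := by
    rintro ⟨a, ha⟩
    obtain ⟨P, hP, hPc⟩ := h a (by simpa using ha)
    obtain ⟨r, hr, hb⟩ := Metric.eventually_nhds_iff_ball.1
      ((Complex.analyticAt_iff_eventually_differentiableAt.1 hP).and hPc)
    exact ⟨P, r, hr, fun x hx => (hb x hx).1.differentiableWithinAt, fun x hx => (hb x hx).2⟩
  choose P r hr hPd hPc using h'
  obtain ⟨δ₀, hδ₀, hδ⟩ := lebesgue_number_lemma_of_metric (isCompact_sphere (0 : ℂ) 1)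
    (c := fun a : Metric.sphere (0 : ℂ) 1 => Metric.ball (a : ℂ) (r a))
    (fun a => Metric.isOpen_ball)
    (fun x hx => Set.mem_iUnion.2 ⟨⟨x, hx⟩, Metric.mem_ball_self (hr _)⟩)
  have hQ : ∀ b : ℂ, ∃ Q : ℂ → ℂ, ‖b‖ = 1 → DifferentiableOn ℂ Q (Metric.ball b δ₀) ∧
      ∀ x ∈ Metric.ball b δ₀, ‖x‖ = 1 → Q x = c x := by
    intro b
    by_cases hb : ‖b‖ = 1
    · obtain ⟨a, ha⟩ := hδ b (by simpa using hb)
      exact ⟨P a, fun _ => ⟨(hPd a).mono ha, fun x hx => hPc a x (ha hx)⟩⟩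
    · exact ⟨0, fun h => absurd h hb⟩
  choose Q hQ' using hQ
  have hQd := fun b hb => (hQ' b hb).1
  have hQc := fun b hb => (hQ' b hb).2
  -- At `z` the extension centred at the radial projection of `z` is used; the bound `1` excludes
  -- the origin. Two such extensions agree because their balls meet in a convex set containing an
  -- accumulating set of circle points.
  refine ⟨min δ₀ 1, lt_min hδ₀ one_pos, min_le_right _ _, fun z => Q (z / ‖z‖) z, ?_, ?_⟩
  · intro z hz
    have hz0 : ∀ x : ℂ, |‖x‖ - 1| < min δ₀ 1 → x ≠ 0 := by
      rintro x hx rfl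
      simp at hx
    set b := z / ‖z‖ with hb
    have hbn : ‖b‖ = 1 := norm_div_norm_self (hz0 z hz)
    have hzb : z ∈ Metric.ball b δ₀ := by
      rw [Metric.mem_ball, dist_div_norm_self (hz0 z hz)]
      exact hz.trans_le (min_le_left _ _)
    refine ((hQd b hbn).differentiableAt (Metric.isOpen_ball.mem_nhds hzb)).congr_of_eventuallyEq ?_
    have e1 : ∀ᶠ x : ℂ in 𝓝 z, |‖x‖ - 1| < min δ₀ 1 :=
      (isOpen_lt (by fun_prop) continuous_const).mem_nhds hz
    have e2 : ∀ᶠ x : ℂ in 𝓝 z, x / ‖x‖ ∈ Metric.ball b δ₀ := by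
      have : ContinuousAt (fun x : ℂ => x / ‖x‖) z :=
        continuousAt_id.div (by fun_prop) (by exact_mod_cast norm_ne_zero_iff.2 (hz0 z hz))
      exact this.eventually (Metric.ball_mem_nhds b hδ₀)
    filter_upwards [e1, e2, Metric.isOpen_ball.mem_nhds hzb] with x h1 h2 h3
    set b' := x / ‖x‖ with hb'
    have hbn' : ‖b'‖ = 1 := norm_div_norm_self (hz0 x h1)
    have hxb : x ∈ Metric.ball b' δ₀ := by
      rw [Metric.mem_ball, dist_div_norm_self (hz0 x h1)]
      exact h1.trans_le (min_le_left _ _)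
    have hopen : IsOpen (Metric.ball b' δ₀ ∩ Metric.ball b δ₀) :=
      Metric.isOpen_ball.inter Metric.isOpen_ball
    have hmem : b' ∈ Metric.ball b' δ₀ ∩ Metric.ball b δ₀ := ⟨Metric.mem_ball_self hδ₀, h2⟩
    refine (((hQd b' hbn').mono Set.inter_subset_left).analyticOnNhd
      hopen).eqOn_of_preconnected_of_frequently_eq
      (((hQd b hbn).mono Set.inter_subset_right).analyticOnNhd hopen)
      ((convex_ball b' δ₀).inter (convex_ball b δ₀)).isPreconnected hmem ?_ ⟨hxb, h3⟩
    refine ((frequently_norm_eq_one hbn').and_eventually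
      (nhdsWithin_le_nhds (hopen.mem_nhds hmem))).mono ?_
    rintro y ⟨hy1, hy2, hy3⟩
    rw [hQc b' hbn' y hy2 hy1, hQc b hbn y hy3 hy1]
  · intro a ha
    have : a / (‖a‖ : ℂ) = a := by rw [ha]; simp
    simp only [this]
    exact hQc a ha a (Metric.mem_ball_self hδ₀) ha

theorem AnalyticAt.exists_injOn_of_deriv_ne_zero {f : ℂ → ℂ} {a : ℂ} (hf : AnalyticAt ℂ f a)
    (h : deriv f a ≠ 0) : ∃ u ∈ 𝓝 a, Set.InjOn f u := by
  have hs := hf.hasStrictDerivAt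
  refine ⟨_, hs.eventually_left_inverse h, fun x hx y hy hxy => ?_⟩
  have h1 : hs.localInverse f _ a h (f x) = x := hx
  have h2 : hs.localInverse f _ a h (f y) = y := hy
  rw [← h1, hxy, h2]

/-- An analytic Jordan curve has an annular conformal collar. -/
theorem IsRealAnalyticJordanCurve.exists_collar {Γ : Set ℂ} (h : IsRealAnalyticJordanCurve Γ) :
    ∃ ρ > 1, ∃ J : ℂ → ℂ, DifferentiableOn ℂ J {q | ρ⁻¹ < ‖q‖ ∧ ‖q‖ < ρ} ∧
      Set.InjOn J {q | ρ⁻¹ < ‖q‖ ∧ ‖q‖ < ρ} ∧ J '' {q | ‖q‖ = 1} = Γ := by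
  obtain ⟨γ, hγ, hγ', hper, hinj, rfl⟩ := h
  have hpi : (Real.pi : ℂ) ≠ 0 := by exact_mod_cast Real.pi_ne_zero
  have h2pi : (2 * Real.pi * Complex.I : ℂ) ≠ 0 := Complex.two_pi_I_ne_zero
  set e : ℝ → ℂ := fun t => Complex.exp (2 * Real.pi * Complex.I * t) with he
  have hen : ∀ t, ‖e t‖ = 1 := fun t => by
    have : (2 * Real.pi * Complex.I * t : ℂ) = ((2 * Real.pi * t : ℝ) : ℂ) * Complex.I := by
      push_cast; ring
    simp only [he]
    rw [this, Complex.norm_exp_ofReal_mul_I]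
  have hee : ∀ s t, e s = e t → γ s = γ t := by
    intro s t hst
    obtain ⟨n, hn⟩ := Complex.exp_eq_exp_iff_exists_int.1 hst
    have h1 : (s : ℂ) = t + n := by
      apply mul_left_cancel₀ h2pi
      rw [hn]; ring
    have h2 : s = t + n := by exact_mod_cast h1
    rw [h2]
    simpa using hper.int_mul n t
  set c : ℂ → ℂ := fun q => γ (q.arg / (2 * Real.pi)) with hc
  have hearg : ∀ q : ℂ, ‖q‖ = 1 → e (q.arg / (2 * Real.pi)) = q := by
    intro q hq
    have h1 := Complex.norm_mul_exp_arg_mul_I q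
    rw [hq, Complex.ofReal_one, one_mul] at h1
    simp only [he]
    push_cast
    rw [show (2 * Real.pi * Complex.I * (q.arg / (2 * Real.pi)) : ℂ) = q.arg * Complex.I by
      field_simp, h1]
  have hce : ∀ t, c (e t) = γ t := fun t => hee _ _ (hearg _ (hen t))
  have hloc : ∀ a : ℂ, ‖a‖ = 1 →
      ∃ P : ℂ → ℂ, AnalyticAt ℂ P a ∧ ∀ᶠ x in 𝓝 a, ‖x‖ = 1 → P x = c x := by
    intro a ha
    have ha0 : a ≠ 0 := norm_pos_iff.1 (by rw [ha]; exact one_pos)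
    set t₀ := a.arg / (2 * Real.pi) with ht₀
    obtain ⟨g, hg, hgγ⟩ := (hγ t₀ trivial).exists_complexification
    -- A complex angle coordinate: the logarithm is centred at `a`, which keeps its branch cut away
    -- from `a`.
    set L : ℂ → ℂ := fun x => t₀ + Complex.log (x / a) / (2 * Real.pi * Complex.I) with hL
    have hLa : L a = t₀ := by simp [hL, ha0]
    have hLan : AnalyticAt ℂ L a := by
      have h1 : AnalyticAt ℂ (fun x : ℂ => x / a) a := analyticAt_id.div analyticAt_const ha0
      have h2 : a / a ∈ Complex.slitPlane := by rw [div_self ha0]; exact Complex.one_mem_slitPlane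
      exact analyticAt_const.add ((h1.clog h2).div analyticAt_const h2pi)
    refine ⟨g ∘ L, AnalyticAt.comp (by rw [hLa]; exact hg) hLan, ?_⟩
    have hτ : Tendsto (fun x : ℂ => t₀ + (x / a).arg / (2 * Real.pi)) (𝓝 a) (𝓝 t₀) := by
      have h2 : ContinuousAt Complex.arg (a / a) := Complex.continuousAt_arg (by
        rw [div_self ha0]; exact Complex.one_mem_slitPlane)
      have h3 : ContinuousAt (fun x : ℂ => t₀ + (x / a).arg / (2 * Real.pi)) a :=
        continuousAt_const.add ((ContinuousAt.comp (f := fun x : ℂ => x / a) h2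
          (by fun_prop)).div_const _)
      simpa [ContinuousAt, ha0] using h3
    filter_upwards [hτ.eventually hgγ] with x hx hx1
    set τ := t₀ + (x / a).arg / (2 * Real.pi) with hτd
    have hxa : ‖x / a‖ = 1 := by rw [norm_div, hx1, ha, div_one]
    have hLx : L x = τ := by
      simp only [hL, hτd, Complex.log, hxa]
      push_cast
      rw [Real.log_one]
      field_simp
      push_cast
      ring
    have heτ : e τ = x := by
      have h1 := hearg _ ha
      have h2 := hearg _ hxa
      have h3 : e τ = e t₀ * e ((x / a).arg / (2 * Real.pi)) := by
        simp only [he, hτd]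
        rw [← Complex.exp_add]
        push_cast
        ring_nf
      rw [h3, h1, h2]
      field_simp
    change g (L x) = c x
    rw [hLx, hx, ← heτ, hce]
  obtain ⟨δ, hδ, hδ1, J, hJd, hJc⟩ := exists_holomorphic_of_local_extension hloc
  have hJe : ∀ t, J (e t) = γ t := fun t => by rw [hJc _ (hen t), hce]
  have hJa : ∀ a : ℂ, ‖a‖ = 1 → AnalyticAt ℂ J a := by
    intro a ha
    refine Complex.analyticAt_iff_eventually_differentiableAt.2 ?_
    have : ∀ᶠ x : ℂ in 𝓝 a, |‖x‖ - 1| < δ :=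
      (isOpen_lt (by fun_prop) continuous_const).mem_nhds (by simpa [ha] using hδ)
    exact this.mono hJd
  have hJ' : ∀ a : ℂ, ‖a‖ = 1 → deriv J a ≠ 0 := by
    intro a ha h0
    set t₀ := a.arg / (2 * Real.pi) with ht₀
    have h1 : HasDerivAt J 0 (e t₀) := by
      rw [hearg a ha, ← h0]; exact (hJa a ha).differentiableAt.hasDerivAt
    have h2 : HasDerivAt e (e t₀ * (2 * Real.pi * Complex.I * 1)) t₀ := by
      have h3 : HasDerivAt (fun t : ℝ => (2 * Real.pi * Complex.I * t : ℂ))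
          (2 * Real.pi * Complex.I * 1) t₀ := (HasDerivAt.ofReal_comp (hasDerivAt_id t₀)).const_mul _
      exact h3.cexp
    have h4 := HasDerivAt.comp t₀ h1 h2
    have h5 : HasDerivAt γ (0 * (e t₀ * (2 * Real.pi * Complex.I * 1))) t₀ := by
      refine h4.congr_of_eventuallyEq (Eventually.of_forall fun t => (hJe t).symm)
    exact hγ' t₀ (by simpa using h5.deriv)
  have hJinj : Set.InjOn J (Metric.sphere 0 1) := by
    have hrep : ∀ q : ℂ, ‖q‖ = 1 → ∃ t ∈ Set.Ico (0 : ℝ) 1, e t = q := by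
      intro q hq
      set s := q.arg / (2 * Real.pi) with hs
      refine ⟨Int.fract s, ⟨Int.fract_nonneg _, Int.fract_lt_one _⟩, ?_⟩
      rw [← hearg q hq]
      simp only [he]
      refine Complex.exp_eq_exp_iff_exists_int.2 ⟨-⌊s⌋, ?_⟩
      rw [← hs, Int.fract]
      push_cast
      ring
    intro x hx y hy hxy
    obtain ⟨s, hs, rfl⟩ := hrep x (by simpa using hx)
    obtain ⟨t, ht, rfl⟩ := hrep y (by simpa using hy)
    rw [hJe, hJe] at hxy
    rw [hinj hs ht hxy]
  -- Injectivity on the compact circle plus local injectivity at its points, from `J' ≠ 0`, gives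
  -- injectivity on a whole neighbourhood.
  obtain ⟨u, hu, hui⟩ := hJinj.exists_mem_nhdsSet (isCompact_sphere _ _)
    (fun x hx => (hJa x (by simpa using hx)).continuousAt)
    (fun x hx => (hJa x (by simpa using hx)).exists_injOn_of_deriv_ne_zero
      (hJ' x (by simpa using hx)))
  obtain ⟨V, hVo, hsV, hVu⟩ := mem_nhdsSet_iff_exists.1 hu
  obtain ⟨ε, hε, hεV⟩ := (isCompact_sphere (0 : ℂ) 1).exists_thickening_subset_open hVo hsV
  set m := min δ ε with hm
  have hm0 : 0 < m := lt_min hδ hε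
  have hsub : ∀ q : ℂ, (1 + m / 2)⁻¹ < ‖q‖ → ‖q‖ < 1 + m / 2 → |‖q‖ - 1| < m := by
    intro q h1 h2
    have h3 : 1 - m / 2 ≤ (1 + m / 2)⁻¹ := by
      rw [← one_div, le_div_iff₀ (by positivity)]
      nlinarith
    rw [abs_lt]; constructor <;> linarith
  refine ⟨1 + m / 2, by simpa using by linarith, J, ?_, ?_, ?_⟩
  · rintro q ⟨h1, h2⟩
    exact (hJd q ((hsub q h1 h2).trans_le (min_le_left _ _))).differentiableWithinAt
  · refine hui.mono ?_
    rintro q ⟨h1, h2⟩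
    have hq0 : q ≠ 0 := norm_pos_iff.1 ((by positivity : (0 : ℝ) < (1 + m / 2)⁻¹).trans h1)
    refine hVu (hεV (Metric.mem_thickening_iff.2 ⟨q / ‖q‖, ?_, ?_⟩))
    · simpa using norm_div_norm_self hq0
    · rw [dist_div_norm_self hq0]
      exact (hsub q h1 h2).trans_le (min_le_right _ _)
  · ext y
    constructor
    · rintro ⟨q, hq, rfl⟩
      exact ⟨_, (hJc q hq).symm⟩
    · rintro ⟨t, rfl⟩
      exact ⟨e t, hen t, hJe t⟩

/-! ### Extension of the inverse conformal map across the unit circle -/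

theorem IsPreconnected.lt_or_lt_of_ne {X : Type*} [TopologicalSpace X] {s : Set X}
    (hs : IsPreconnected s) {f : X → ℝ} (hf : ContinuousOn f s) {c : ℝ} (hc : ∀ x ∈ s, f x ≠ c) :
    (∀ x ∈ s, f x < c) ∨ ∀ x ∈ s, c < f x := by
  by_contra! h
  obtain ⟨⟨x, hx, hxc⟩, y, hy, hyc⟩ := h
  obtain ⟨z, hz, hzc⟩ := hs.intermediate_value hy hx hf ⟨hyc, hxc⟩
  exact hc z hz hzc

/-- A neighbourhood of the unit circle contains an inner collar. -/
theorem exists_inner_collar_subset {V : Set ℂ} (hV : IsOpen V) (h : Metric.sphere 0 1 ⊆ V) :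
    ∃ r, r < 1 ∧ ∀ w : ℂ, r < ‖w‖ → ‖w‖ < 1 → w ∈ V := by
  obtain ⟨ε, hε, hεV⟩ := (isCompact_sphere (0 : ℂ) 1).exists_thickening_subset_open hV h
  refine ⟨max 0 (1 - ε), max_lt one_pos (by linarith), fun w h1 h2 => hεV ?_⟩
  have hw0 : w ≠ 0 := norm_pos_iff.1 ((le_max_left _ _).trans_lt h1)
  refine Metric.mem_thickening_iff.2 ⟨w / ‖w‖, by simpa using norm_div_norm_self hw0, ?_⟩
  rw [dist_div_norm_self hw0, abs_lt]
  have := (le_max_right _ _).trans_lt h1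
  constructor <;> linarith

namespace IsConformalOntoExterior

variable {Φ : ℂ → ℂ} {Ω : Set ℂ}

/-- The inverse conformal map sends thin collars of the unit circle near the boundary. -/
theorem exists_collar_mapsTo (hΦ : IsConformalOntoExterior Φ Ω) (hΩ : IsOpen Ω) {M : ℝ}
    (hM : 0 < M) (hMΩ : {z : ℂ | M < ‖z‖} ⊆ Ω) {N : Set ℂ} (hN : IsOpen N)
    (hΓN : frontier Ω ⊆ N) :
    ∃ ρ > 1, ∀ w, 1 < ‖w‖ → ‖w‖ < ρ → exteriorInverse Φ Ω w ∈ N := by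
  have hlim := hΦ.tendsto_cobounded hΩ hM hMΩ
  obtain ⟨C, hC⟩ : ∃ C, ∀ z : ℂ, C < ‖z‖ → 2 < ‖Φ z‖ := by
    have h1 := (tendsto_norm_cobounded_atTop.comp hlim).eventually (eventually_gt_atTop 2)
    obtain ⟨C, -, hC⟩ := (Metric.hasBasis_cobounded_compl_closedBall (0 : ℂ)).eventually_iff.1 h1
    exact ⟨C, fun z hz => hC (by simpa using hz)⟩
  -- Points of `closure Ω` off `N` lie in `Ω`. On their bounded part `S` compactness keeps `‖Φ‖`
  -- above some `m > 1`, and beyond radius `C` it exceeds `2`.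
  set S := (closure Ω \ N) ∩ Metric.closedBall 0 C with hS
  have hSc : IsCompact S :=
    (isCompact_closedBall 0 C).inter_left (isClosed_closure.sdiff hN)
  have hSΩ : S ⊆ Ω := by
    rintro z ⟨⟨h1, h2⟩, -⟩
    by_contra h3
    exact h2 (hΓN (by rw [hΩ.frontier_eq]; exact ⟨h1, h3⟩))
  have hmin : ∃ m > 1, ∀ z ∈ S, m ≤ ‖Φ z‖ := by
    rcases S.eq_empty_or_nonempty with h | h
    · exact ⟨2, one_lt_two, by simp [h]⟩
    · obtain ⟨z, hz, hzm⟩ := hSc.exists_isMinOn h ((hΦ.1.continuousOn.mono hSΩ).norm)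
      exact ⟨_, hΦ.2.mapsTo (hSΩ hz), fun y hy => hzm hy⟩
  obtain ⟨m, hm, hmS⟩ := hmin
  refine ⟨min m 2, lt_min hm one_lt_two, fun w h1 h2 => ?_⟩
  by_contra hN'
  have hw := hΦ.inverse_mem h1
  have h3 : exteriorInverse Φ Ω w ∈ S := by
    refine ⟨⟨subset_closure hw, hN'⟩, ?_⟩
    rw [mem_closedBall_zero_iff]
    by_contra h4
    have := hC _ (not_le.1 h4)
    rw [hΦ.apply_inverse h1] at this
    exact (this.trans (h2.trans_le (min_le_right _ _))).false
  have h5 := hmS _ h3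
  rw [hΦ.apply_inverse h1] at h5
  exact (h5.trans_lt (h2.trans_le (min_le_left _ _))).false

/-- The inverse tends to infinity at infinity, so only the image of a compact part can accumulate at
a given point. -/
theorem isClosed_image_inverse (hΦ : IsConformalOntoExterior Φ Ω) (hΩ : IsOpen Ω) {M : ℝ}
    (hM : 0 < M) (hMΩ : {z : ℂ | M < ‖z‖} ⊆ Ω) {R : ℝ} (hR : 1 < R) :
    IsClosed (exteriorInverse Φ Ω '' {w | R ≤ ‖w‖}) := by
  have hlim := hΦ.tendsto_inverse_cobounded hΩ hM hMΩ
  refine isClosed_of_closure_subset fun z hz => ?_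
  rw [mem_closure_iff_frequently] at hz
  have h1 := (tendsto_norm_cobounded_atTop.comp hlim).eventually (eventually_gt_atTop (‖z‖ + 1))
  obtain ⟨C, -, hC⟩ := (Metric.hasBasis_cobounded_compl_closedBall (0 : ℂ)).eventually_iff.1 h1
  set S := {w : ℂ | R ≤ ‖w‖} ∩ Metric.closedBall 0 C with hS
  have hSc : IsCompact S :=
    (isCompact_closedBall 0 C).inter_left (isClosed_le continuous_const continuous_norm)
  have hSi : IsCompact (exteriorInverse Φ Ω '' S) :=
    hSc.image_of_continuousOn ((hΦ.differentiableOn_inverse hΩ).continuousOn.mono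
      fun w hw => hR.trans_le hw.1)
  have h2 : ∃ᶠ y in 𝓝 z, y ∈ exteriorInverse Φ Ω '' S := by
    refine (hz.and_eventually (continuous_norm.continuousAt.eventually
      (gt_mem_nhds (lt_add_one ‖z‖)))).mono ?_
    rintro _ ⟨⟨w, hw, rfl⟩, hy⟩
    refine ⟨w, ⟨hw, ?_⟩, rfl⟩
    by_contra h3
    exact (lt_trans hy (hC h3)).false
  obtain ⟨w, hw, rfl⟩ := hSi.isClosed.closure_subset (mem_closure_iff_frequently.2 h2)
  exact ⟨w, hw.1, rfl⟩

/-- Read in the collar, the inverse map never meets the unit circle, since its values lie in `Ω` and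
not on the frontier. By connectedness it stays on one side, and if that is the inner side, `q ↦ q⁻¹`
exchanges the sides. -/
theorem exists_oriented_collar (hΦ : IsConformalOntoExterior Φ Ω) (hΩ : IsOpen Ω) {M : ℝ}
    (hM : 0 < M) (hMΩ : {z : ℂ | M < ‖z‖} ⊆ Ω) (hΓ : IsRealAnalyticJordanCurve (frontier Ω)) :
    ∃ ρ > 1, ∃ J : ℂ → ℂ, DifferentiableOn ℂ J {q | ρ⁻¹ < ‖q‖ ∧ ‖q‖ < ρ} ∧
      Set.InjOn J {q | ρ⁻¹ < ‖q‖ ∧ ‖q‖ < ρ} ∧ J '' {q | ‖q‖ = 1} = frontier Ω ∧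
      ∃ b > 1, ∀ w, 1 < ‖w‖ → ‖w‖ < b → ∃ q, 1 < ‖q‖ ∧ ‖q‖ < ρ ∧ J q = exteriorInverse Φ Ω w := by
  obtain ⟨ρ, hρ, J, hJ, hJi, hJΓ⟩ := hΓ.exists_collar
  have hρ0 : 0 < ρ := one_pos.trans hρ
  have hρi : ρ⁻¹ < 1 := inv_lt_one_of_one_lt₀ hρ
  have hA := isOpen_annulus ρ⁻¹ ρ
  have hcA : {q : ℂ | ‖q‖ = 1} ⊆ {q | ρ⁻¹ < ‖q‖ ∧ ‖q‖ < ρ} := fun q hq => by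
    have hq' : ‖q‖ = 1 := hq
    exact ⟨by rw [hq']; exact hρi, by rw [hq']; exact hρ⟩
  obtain ⟨b, hb, hbN⟩ := hΦ.exists_collar_mapsTo hΩ hM hMΩ (isOpen_image_of_injOn hA hJ hJi)
    (by rw [← hJΓ]; exact Set.image_mono hcA)
  have hg := hJi.leftInvOn_invFunOn
  set g := Function.invFunOn J {q | ρ⁻¹ < ‖q‖ ∧ ‖q‖ < ρ} with hgdef
  have hgd := differentiableOn_leftInverse_of_injOn hA hJ hg
  have hcont : ContinuousOn (fun w => ‖g (exteriorInverse Φ Ω w)‖) {w | 1 < ‖w‖ ∧ ‖w‖ < b} :=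
    (hgd.continuousOn.comp ((hΦ.differentiableOn_inverse hΩ).continuousOn.mono fun w hw => hw.1)
      fun w hw => hbN w hw.1 hw.2).norm
  have hne : ∀ w ∈ {w : ℂ | 1 < ‖w‖ ∧ ‖w‖ < b}, ‖g (exteriorInverse Φ Ω w)‖ ≠ 1 := by
    rintro w ⟨h1, h2⟩ h3
    obtain ⟨q, hq, hqw⟩ := hbN w h1 h2
    have h4 : exteriorInverse Φ Ω w ∈ frontier Ω := by
      rw [← hJΓ]
      refine ⟨q, ?_, hqw⟩
      rw [← hqw, hg hq] at h3
      exact h3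
    rw [hΩ.frontier_eq] at h4
    exact h4.2 (hΦ.inverse_mem h1)
  rcases (isPreconnected_annulus zero_le_one).lt_or_lt_of_ne hcont hne with h | h
  · have hmaps : Set.MapsTo (fun q : ℂ => q⁻¹) {q | ρ⁻¹ < ‖q‖ ∧ ‖q‖ < ρ}
        {q | ρ⁻¹ < ‖q‖ ∧ ‖q‖ < ρ} := by
      rintro q ⟨h1, h2⟩
      have hq : 0 < ‖q‖ := (inv_pos.2 hρ0).trans h1
      change ρ⁻¹ < ‖q⁻¹‖ ∧ ‖q⁻¹‖ < ρ
      rw [norm_inv]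
      exact ⟨inv_strictAnti₀ hq h2, inv_lt_of_inv_lt₀ hρ0 h1⟩
    refine ⟨ρ, hρ, J ∘ fun q => q⁻¹, ?_, ?_, ?_, b, hb, ?_⟩
    · refine hJ.comp (fun q hq => ?_) hmaps
      have hq : 0 < ‖q‖ := (inv_pos.2 hρ0).trans hq.1
      exact (differentiableAt_inv (norm_pos_iff.1 hq)).differentiableWithinAt
    · exact hJi.comp inv_injective.injOn hmaps
    · rw [Set.image_comp, ← hJΓ]
      congr 1
      ext q
      constructor
      · rintro ⟨x, hx, rfl⟩
        have hx' : ‖x‖ = 1 := hx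
        change ‖x⁻¹‖ = 1
        rw [norm_inv, hx', inv_one]
      · intro hq
        have hq' : ‖q‖ = 1 := hq
        refine ⟨q⁻¹, ?_, inv_inv q⟩
        change ‖q⁻¹‖ = 1
        rw [norm_inv, hq', inv_one]
    · intro w h1 h2
      obtain ⟨q, hq, hqw⟩ := hbN w h1 h2
      have h3 := h w ⟨h1, h2⟩
      simp only [← hqw, hg hq] at h3
      have hq0 : 0 < ‖q‖ := (inv_pos.2 hρ0).trans hq.1
      refine ⟨q⁻¹, ?_, (hmaps hq).2, by simpa using hqw⟩
      rw [norm_inv]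
      exact (one_lt_inv₀ hq0).2 h3
  · refine ⟨ρ, hρ, J, hJ, hJi, hJΓ, b, hb, fun w h1 h2 => ?_⟩
    obtain ⟨q, hq, hqw⟩ := hbN w h1 h2
    have h3 := h w ⟨h1, h2⟩
    simp only [← hqw, hg hq] at h3
    exact ⟨q, h3, hq.2, hqw⟩

/-- The inverse conformal map extends holomorphically across the unit circle. -/
theorem exists_extension (hΦ : IsConformalOntoExterior Φ Ω) (hΩ : IsOpen Ω) {M : ℝ}
    (hM : 0 < M) (hMΩ : {z : ℂ | M < ‖z‖} ⊆ Ω) (hΓ : IsRealAnalyticJordanCurve (frontier Ω)) :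
    ∃ r, 0 < r ∧ r < 1 ∧ ∃ Ψ : ℂ → ℂ, DifferentiableOn ℂ Ψ {w | r < ‖w‖} ∧
      (∀ w, 1 < ‖w‖ → Ψ w = exteriorInverse Φ Ω w) ∧ Set.InjOn Ψ {w | 1 ≤ ‖w‖} ∧
      Ψ '' {w | ‖w‖ = 1} = frontier Ω ∧
      ∀ w u, r < ‖w‖ → ‖w‖ < 1 → 1 ≤ ‖u‖ → Ψ w ≠ Ψ u := by
  obtain ⟨ρ, hρ, J, hJ, hJi, hJΓ, b, hb, hbJ⟩ := hΦ.exists_oriented_collar hΩ hM hMΩ hΓ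
  set ψ := exteriorInverse Φ Ω with hψ
  have hψd := hΦ.differentiableOn_inverse hΩ
  have hρ0 : 0 < ρ := one_pos.trans hρ
  have hρi : ρ⁻¹ < 1 := inv_lt_one_of_one_lt₀ hρ
  have hA := isOpen_annulus ρ⁻¹ ρ
  have hg := hJi.leftInvOn_invFunOn
  set g := Function.invFunOn J {q | ρ⁻¹ < ‖q‖ ∧ ‖q‖ < ρ} with hgdef
  have hgd := differentiableOn_leftInverse_of_injOn hA hJ hg
  -- In the collar coordinate the boundary is the unit circle, so `|T| → 1` there and reflection
  -- applies.
  set T : ℂ → ℂ := g ∘ ψ with hT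
  have hTq : ∀ w, 1 < ‖w‖ → ‖w‖ < b → 1 < ‖T w‖ ∧ ‖T w‖ < ρ ∧ J (T w) = ψ w := by
    intro w h1 h2
    obtain ⟨q, hq1, hq2, hqw⟩ := hbJ w h1 h2
    have : T w = q := by
      rw [hT, Function.comp, ← hqw]; exact hg ⟨hρi.trans hq1, hq2⟩
    rw [this]; exact ⟨hq1, hq2, hqw⟩
  have hTd : DifferentiableOn ℂ T {w | 1 < ‖w‖ ∧ ‖w‖ < b} :=
    hgd.comp (hψd.mono fun w hw => hw.1) fun w hw =>
      ⟨T w, ⟨hρi.trans (hTq w hw.1 hw.2).1, (hTq w hw.1 hw.2).2.1⟩, (hTq w hw.1 hw.2).2.2⟩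
  have hTi : Set.InjOn T {w | 1 < ‖w‖ ∧ ‖w‖ < b} := by
    intro x hx y hy h
    refine hΦ.injOn_inverse hx.1 hy.1 ?_
    rw [← hψ, ← (hTq x hx.1 hx.2).2.2, h, (hTq y hy.1 hy.2).2.2]
  have hlim : ∀ ε > 0, ∃ ρ' > 1, ∀ w, 1 < ‖w‖ → ‖w‖ < ρ' → |‖T w‖ - 1| < ε := by
    intro ε hε
    have hsub : {q : ℂ | max ρ⁻¹ (1 - ε) < ‖q‖ ∧ ‖q‖ < min ρ (1 + ε)} ⊆
        {q | ρ⁻¹ < ‖q‖ ∧ ‖q‖ < ρ} := fun q hq =>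
      ⟨(le_max_left _ _).trans_lt hq.1, hq.2.trans_le (min_le_left _ _)⟩
    obtain ⟨ρ', hρ', hN⟩ := hΦ.exists_collar_mapsTo hΩ hM hMΩ
      (isOpen_image_of_injOn (isOpen_annulus _ _) (hJ.mono hsub) (hJi.mono hsub)) (by
        rw [← hJΓ]
        refine Set.image_mono fun q hq => ?_
        have hq' : ‖q‖ = 1 := hq
        change _ ∧ _
        rw [hq']
        exact ⟨max_lt hρi (by linarith), lt_min hρ (by linarith)⟩)
    refine ⟨min ρ' b, lt_min hρ' hb, fun w h1 h2 => ?_⟩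
    obtain ⟨q, hq, hqw⟩ := hN w h1 (h2.trans_le (min_le_left _ _))
    have : T w = q := by rw [hT, Function.comp, hψ, ← hqw]; exact hg (hsub hq)
    rw [this, abs_lt]
    have h3 := (le_max_right _ _).trans_lt hq.1
    have h4 := hq.2.trans_le (min_le_right _ _)
    constructor <;> linarith
  set R := (1 + b) / 2 with hR
  have hR1 : 1 < R := by rw [hR]; linarith
  have hRb : R < b := by rw [hR]; linarith
  have hR0 : 0 < R := one_pos.trans hR1
  have hRi : R⁻¹ < 1 := inv_lt_one_of_one_lt₀ hR1
  obtain ⟨S, hS, hST, hS1, hSrefl, hSinj⟩ := exists_reflection hR1 hRb hTd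
    (fun w h1 h2 => (hTq w h1 h2).1) hTi hlim
  have hSin : ∀ w, R⁻¹ < ‖w‖ → ‖w‖ < 1 → ρ⁻¹ < ‖S w‖ ∧ ‖S w‖ < 1 := by
    intro w h1 h2
    have hw0 : 0 < ‖w‖ := (inv_pos.2 hR0).trans h1
    have h4 : 1 < ‖((starRingEnd ℂ) w)⁻¹‖ := by
      rw [norm_inv_conj]; exact (one_lt_inv₀ hw0).2 h2
    have h5 : ‖((starRingEnd ℂ) w)⁻¹‖ < R := by
      rw [norm_inv_conj]; exact inv_lt_of_inv_lt₀ hR0 h1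
    have h6 := hSrefl w h1 (h2.trans hR1)
    rw [hST _ h4 h5] at h6
    obtain ⟨h7, h8, -⟩ := hTq _ h4 (h5.trans hRb)
    rw [eq_inv_of_mul_eq_one_left h6]
    exact ⟨inv_strictAnti₀ (one_pos.trans h7) h8, inv_lt_one_of_one_lt₀ h7⟩
  have hSA : Set.MapsTo S {w | R⁻¹ < ‖w‖ ∧ ‖w‖ < R} {q | ρ⁻¹ < ‖q‖ ∧ ‖q‖ < ρ} := by
    rintro w ⟨h1, h2⟩
    rcases lt_trichotomy ‖w‖ 1 with h | h | h
    · exact ⟨(hSin w h1 h).1, (hSin w h1 h).2.trans hρ⟩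
    · exact ⟨by rw [hS1 w h]; exact hρi, by rw [hS1 w h]; exact hρ⟩
    · rw [Set.mem_ofPred_eq, hST w h h2]
      have := hTq w h (h2.trans hRb)
      exact ⟨hρi.trans this.1, this.2.1⟩
  have hJS : DifferentiableOn ℂ (J ∘ S) {w | R⁻¹ < ‖w‖ ∧ ‖w‖ < R} := hJ.comp hS hSA
  have hJS1 : ∀ w, ‖w‖ = 1 → J (S w) ∈ frontier Ω := fun w hw => by
    rw [← hJΓ]; exact ⟨S w, hS1 w hw, rfl⟩
  -- Values on the inner collar must avoid those on `‖u‖ ≥ 1`. For `‖u‖ < R` injectivity of `J`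
  -- separates them; for `‖u‖ ≥ R` the collar is shrunk until `J ∘ S` misses the closed set `F`,
  -- which is disjoint from the frontier.
  set F := ψ '' {w | R ≤ ‖w‖} with hF
  have hFc : IsClosed F := hΦ.isClosed_image_inverse hΩ hM hMΩ hR1
  have hFΩ : F ⊆ Ω := by
    rintro _ ⟨w, hw, rfl⟩
    exact hΦ.inverse_mem (hR1.trans_le hw)
  have hΓΩ : ∀ z ∈ frontier Ω, z ∉ Ω := fun z hz => by
    rw [hΩ.frontier_eq] at hz; exact hz.2
  obtain ⟨r₀, hr₀, hr₀V⟩ := exists_inner_collar_subset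
    (hJS.continuousOn.isOpen_inter_preimage (isOpen_annulus _ _) hFc.isOpen_compl) (by
      intro w hw
      have hw' : ‖w‖ = 1 := by simpa using hw
      refine ⟨⟨by rw [hw']; exact hRi, by rw [hw']; exact hR1⟩, fun h => ?_⟩
      exact hΓΩ _ (hJS1 w hw') (hFΩ h))
  set Ψ : ℂ → ℂ := fun w => if 1 < ‖w‖ then ψ w else J (S w) with hΨ
  have hΨ1 : ∀ w, 1 < ‖w‖ → Ψ w = ψ w := fun w hw => if_pos hw
  have hΨ2 : ∀ w, ‖w‖ < R → Ψ w = J (S w) := by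
    intro w hw
    by_cases h : 1 < ‖w‖
    · rw [hΨ1 w h, hST w h hw, (hTq w h (hw.trans hRb)).2.2]
    · exact if_neg h
  have hΨd : DifferentiableOn ℂ Ψ {w | R⁻¹ < ‖w‖} := by
    intro w hw
    refine DifferentiableAt.differentiableWithinAt ?_
    by_cases h : 1 < ‖w‖
    · have ho : IsOpen {w : ℂ | 1 < ‖w‖} := isOpen_lt continuous_const continuous_norm
      refine (hψd.differentiableAt (ho.mem_nhds h)).congr_of_eventuallyEq ?_
      filter_upwards [ho.mem_nhds h] with x hx using hΨ1 x hx
    · have hA' := (isOpen_annulus R⁻¹ R).mem_nhds (x := w) ⟨hw, (not_lt.1 h).trans_lt hR1⟩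
      refine (hJS.differentiableAt hA').congr_of_eventuallyEq ?_
      filter_upwards [hA'] with x hx using hΨ2 x hx.2
  have hΨinj : Set.InjOn Ψ {w | 1 ≤ ‖w‖} := by
    intro x hx y hy h
    rcases (show 1 ≤ ‖x‖ from hx).eq_or_lt with h1 | h1 <;>
      rcases (show 1 ≤ ‖y‖ from hy).eq_or_lt with h2 | h2
    · rw [hΨ2 x (h1.symm.trans_lt hR1), hΨ2 y (h2.symm.trans_lt hR1)] at h
      refine hSinj h1.symm h2.symm (hJi ?_ ?_ h) <;> refine hSA ⟨?_, ?_⟩ <;> linarith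
    · rw [hΨ2 x (h1.symm.trans_lt hR1), hΨ1 y h2] at h
      exact absurd (hΦ.inverse_mem h2) (by rw [← hψ, ← h]; exact hΓΩ _ (hJS1 x h1.symm))
    · rw [hΨ1 x h1, hΨ2 y (h2.symm.trans_lt hR1)] at h
      exact absurd (hΦ.inverse_mem h1) (by rw [← hψ, h]; exact hΓΩ _ (hJS1 y h2.symm))
    · rw [hΨ1 x h1, hΨ1 y h2] at h
      exact hΦ.injOn_inverse h1 h2 h
  refine ⟨max R⁻¹ r₀, (inv_pos.2 hR0).trans_le (le_max_left _ _), max_lt hRi hr₀, Ψ,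
    hΨd.mono fun w hw => (le_max_left R⁻¹ r₀).trans_lt (show _ < ‖w‖ from hw), hΨ1, hΨinj, ?_, ?_⟩
  · refine Set.Subset.antisymm ?_ fun z hz => ?_
    · rintro _ ⟨w, hw, rfl⟩
      have hw' : ‖w‖ = 1 := hw
      rw [hΨ2 w (hw'.trans_lt hR1)]
      exact hJS1 w hw'
    -- A frontier point is a limit of points of `Ω`, which is covered by a compact image and the
    -- closed `F`. Values of `Ψ` at `‖w‖ > 1` lie in the open set `Ω`, so the point is attained at
    -- `‖w‖ = 1`.
    · have hcomp : IsCompact (Ψ '' ({w | 1 ≤ ‖w‖} ∩ Metric.closedBall 0 R)) :=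
        ((isCompact_closedBall 0 R).inter_left
          (isClosed_le continuous_const continuous_norm)).image_of_continuousOn
          (hΨd.continuousOn.mono fun w hw => hRi.trans_le hw.1)
      have hsub : Ω ⊆ Ψ '' ({w | 1 ≤ ‖w‖} ∩ Metric.closedBall 0 R) ∪ F := by
        intro y hy
        have hy1 : 1 < ‖Φ y‖ := hΦ.2.mapsTo hy
        have hy2 : ψ (Φ y) = y := hΦ.leftInvOn hy
        rcases le_total R ‖Φ y‖ with h | h
        · exact Or.inr ⟨Φ y, h, hy2⟩
        · exact Or.inl ⟨Φ y, ⟨hy1.le, by simpa using h⟩, by rw [hΨ1 _ hy1, hy2]⟩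
      rcases closure_minimal hsub (hcomp.isClosed.union hFc) (frontier_subset_closure hz) with h | h
      · obtain ⟨w, ⟨hw, -⟩, rfl⟩ := h
        rcases (show 1 ≤ ‖w‖ from hw).eq_or_lt with h1 | h1
        · exact ⟨w, h1.symm, rfl⟩
        · rw [hΨ1 w h1] at hz
          exact absurd (hΦ.inverse_mem h1) (hΓΩ _ hz)
      · exact absurd (hFΩ h) (hΓΩ z hz)
  · intro w u h1 h2 h3 h
    have hwR : R⁻¹ < ‖w‖ := (le_max_left _ _).trans_lt h1
    rw [hΨ2 w (h2.trans hR1)] at h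
    rcases lt_or_ge ‖u‖ R with hu | hu
    · rw [hΨ2 u hu] at h
      have h4 := hJi (hSA ⟨hwR, h2.trans hR1⟩) (hSA ⟨hRi.trans_le h3, hu⟩) h
      have h5 := (hSin w hwR h2).2
      rw [h4] at h5
      rcases h3.eq_or_lt with h6 | h6
      · exact h5.ne (hS1 u h6.symm)
      · rw [hST u h6 hu] at h5
        exact h5.not_gt (hTq u h6 (hu.trans hRb)).1
    · have h4 := (hr₀V w ((le_max_right _ _).trans_lt h1) h2).2
      refine h4 ⟨u, hu, ?_⟩
      rw [← hΨ1 u (hR1.trans_le hu)]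
      exact h.symm

end IsConformalOntoExterior

/-! ### Faber polynomials -/

/-- Two-sided linear growth and bounded derivative near infinity of a map with a simple pole
there. -/
theorem exists_growth_bounds {Ψ : ℂ → ℂ} {r : ℝ} (hΨ : DifferentiableOn ℂ Ψ {w | r < ‖w‖})
    {c : ℂ} (hc : c ≠ 0) (hlim : Tendsto (fun w => Ψ w / w) (Bornology.cobounded ℂ) (𝓝 c)) :
    ∃ R > 1, r < R ∧ ∃ a > 0, ∃ d > 0, ∀ w, R ≤ ‖w‖ → a * ‖w‖ ≤ ‖Ψ w‖ ∧ ‖deriv Ψ w‖ ≤ d := by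
  have hc' : 0 < ‖c‖ := norm_pos_iff.2 hc
  have h1 : ∀ᶠ w in Bornology.cobounded ℂ, ‖c‖ / 2 < ‖Ψ w / w‖ ∧ ‖Ψ w / w‖ < 2 * ‖c‖ :=
    (hlim.norm.eventually (lt_mem_nhds (by linarith))).and
      (hlim.norm.eventually (gt_mem_nhds (by linarith)))
  obtain ⟨C, -, hC⟩ := (Metric.hasBasis_cobounded_compl_closedBall (0 : ℂ)).eventually_iff.1 h1
  set R₁ := max (max C r) 1 with hR₁
  have hR₁1 : 1 ≤ R₁ := le_max_right _ _
  have hR₁C : C ≤ R₁ := (le_max_left _ _).trans (le_max_left _ _)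
  have hR₁r : r ≤ R₁ := (le_max_right _ _).trans (le_max_left _ _)
  have hb : ∀ w, R₁ < ‖w‖ → ‖c‖ / 2 * ‖w‖ ≤ ‖Ψ w‖ ∧ ‖Ψ w‖ ≤ 2 * ‖c‖ * ‖w‖ := by
    intro w hw
    have hw0 : 0 < ‖w‖ := by linarith
    have h := hC (x := w) (by simpa using hR₁C.trans_lt hw)
    rw [norm_div, lt_div_iff₀ hw0, div_lt_iff₀ hw0] at h
    exact ⟨h.1.le, h.2.le⟩
  -- The factor `4` keeps the disc of radius `‖w‖ / 2` about `w` where the growth bounds hold;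
  -- Cauchy's estimate on it gives `3‖c‖‖w‖ / (‖w‖/2) = 6‖c‖`.
  refine ⟨4 * R₁, by linarith, by linarith, ‖c‖ / 2, by positivity, 6 * ‖c‖, by positivity,
    fun w hw => ⟨(hb w (by linarith)).1, ?_⟩⟩
  have hw0 : 0 < ‖w‖ := by linarith
  have hball : ∀ x ∈ Metric.closedBall w (‖w‖ / 2), R₁ < ‖x‖ ∧ ‖x‖ ≤ 3 / 2 * ‖w‖ := by
    intro x hx
    rw [mem_closedBall_iff_norm] at hx
    have h2 := norm_sub_norm_le w x
    have h3 := norm_sub_norm_le x w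
    rw [norm_sub_rev] at h2
    constructor <;> linarith
  have hd : DiffContOnCl ℂ Ψ (Metric.ball w (‖w‖ / 2)) :=
    (hΨ.mono fun x hx => hR₁r.trans_lt
      (hball x (Metric.closure_ball_subset_closedBall hx)).1).diffContOnCl
  refine (Complex.norm_deriv_le_of_forall_mem_sphere_norm_le (C := 3 * ‖c‖ * ‖w‖) (by positivity)
    hd fun x hx => ?_).trans (le_of_eq (by field_simp; norm_num))
  have h4 := hball x (Metric.sphere_subset_closedBall hx)
  refine (hb x h4.1).2.trans ?_
  nlinarith [h4.2]

/-- The `m`-th Faber polynomial attached to the exterior map `Ψ`, computed on the circle of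
radius `R`. -/
noncomputable def faberPolynomial (Ψ : ℂ → ℂ) (R : ℝ) (m : ℕ) : Polynomial ℂ :=
  ∑ k ∈ Finset.range (m + 1), Polynomial.C ((2 * Real.pi * Complex.I : ℂ)⁻¹ •
    ∮ w in C(0, R), w ^ m * deriv Ψ w / Ψ w ^ (k + 1)) * Polynomial.X ^ k

theorem natDegree_faberPolynomial_le (Ψ : ℂ → ℂ) (R : ℝ) (m : ℕ) :
    (faberPolynomial Ψ R m).natDegree ≤ m := by
  refine Polynomial.natDegree_sum_le_of_forall_le _ _ fun k hk => ?_
  exact (Polynomial.natDegree_C_mul_X_pow_le _ _).trans (Finset.mem_range_succ_iff.1 hk)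

theorem geom_expansion {x z : ℂ} (hx : x ≠ 0) (hxz : x - z ≠ 0) (m : ℕ) :
    ∑ k ∈ Finset.range (m + 1), z ^ k / x ^ (k + 1) =
      (x - z)⁻¹ - z ^ (m + 1) / (x ^ (m + 1) * (x - z)) := by
  induction m with
  | zero => simp; field_simp
  | succ n ih => rw [Finset.sum_range_succ, ih]; field_simp; ring

section Faber

variable {Ψ : ℂ → ℂ} {r : ℝ}

theorem isOpen_norm_gt (r : ℝ) : IsOpen {w : ℂ | r < ‖w‖} :=
  isOpen_lt continuous_const continuous_norm

/-- The regular part of the logarithmic derivative of `Ψ - Ψ u` is holomorphic. -/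
theorem exists_regular_part (hΨ : DifferentiableOn ℂ Ψ {w | r < ‖w‖}) {u : ℂ} (hu : r < ‖u‖)
    (hd : deriv Ψ u ≠ 0) (hne : ∀ w, r < ‖w‖ → w ≠ u → Ψ w ≠ Ψ u) :
    ∃ G : ℂ → ℂ, DifferentiableOn ℂ G {w | r < ‖w‖} ∧
      ∀ w, r < ‖w‖ → w ≠ u → G w = deriv Ψ w / (Ψ w - Ψ u) - (w - u)⁻¹ := by
  have hU := isOpen_norm_gt r
  have hD : DifferentiableOn ℂ (dslope Ψ u) {w | r < ‖w‖} :=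
    (Complex.differentiableOn_dslope (hU.mem_nhds hu)).2 hΨ
  have hD0 : ∀ w ∈ {w : ℂ | r < ‖w‖}, dslope Ψ u w ≠ 0 := by
    intro w hw
    rcases eq_or_ne w u with rfl | h
    · rwa [dslope_same]
    · rw [dslope_of_ne _ h, slope_def_field]
      exact div_ne_zero (sub_ne_zero.2 (hne w hw h)) (sub_ne_zero.2 h)
  -- `Ψ - Ψ u` is `w - u` times the zero-free `dslope Ψ u`, so its logarithmic derivative is `1/(w -
  -- u)` plus that of `dslope Ψ u`.
  refine ⟨fun w => deriv (dslope Ψ u) w / dslope Ψ u w, (hD.deriv hU).div hD hD0, ?_⟩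
  intro w hw h
  have h1 : HasDerivAt (fun x => (x - u) * dslope Ψ u x)
      (1 * dslope Ψ u w + (w - u) * deriv (dslope Ψ u) w) w :=
    ((hasDerivAt_id w).sub_const u).mul (hD.differentiableAt (hU.mem_nhds hw)).hasDerivAt
  have h2 : HasDerivAt (fun x => (x - u) * dslope Ψ u x) (deriv Ψ w) w := by
    refine ((hΨ.differentiableAt (hU.mem_nhds hw)).hasDerivAt.sub_const (Ψ u)).congr_of_eventuallyEq
      (Eventually.of_forall fun x => ?_)
    simpa using sub_smul_dslope Ψ u x
  have h3 := h1.unique h2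
  have h4 : (w - u) * dslope Ψ u w = Ψ w - Ψ u := by simpa using sub_smul_dslope Ψ u w
  have h5 := hD0 w hw
  have h6 : w - u ≠ 0 := sub_ne_zero.2 h
  rw [← h3, ← h4]
  field_simp
  ring

/-- The truncated geometric series for `1/(Ψ w - Ψ u)` turns the Faber polynomial into the Cauchy
integral of `w^m Ψ'/(Ψ - Ψ u)` over a large circle, with remainder `O(1/R)`. The simple pole at `u`
contributes `u^m`; the regular part can be integrated over `‖w‖ = s`, where `|w^m| = s^m` makes it
small. -/
theorem eval_faberPolynomial (hΨ : DifferentiableOn ℂ Ψ {w | r < ‖w‖}) (hr : 0 < r)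
    {R₀ a d : ℝ} (hR₀ : 0 < R₀) (hrR₀ : r < R₀) (ha : 0 < a) (hd0 : 0 < d)
    (hgrow : ∀ w, R₀ ≤ ‖w‖ → a * ‖w‖ ≤ ‖Ψ w‖ ∧ ‖deriv Ψ w‖ ≤ d)
    {u : ℂ} {s : ℝ} (hrs : r < s) (hsu : s < ‖u‖)
    (hd : deriv Ψ u ≠ 0) (hne : ∀ w, r < ‖w‖ → w ≠ u → Ψ w ≠ Ψ u) (m : ℕ) :
    (faberPolynomial Ψ (2 * R₀) m).eval (Ψ u) - u ^ m = (2 * Real.pi * Complex.I : ℂ)⁻¹ •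
      ∮ w in C(0, s), w ^ m * (deriv Ψ w / (Ψ w - Ψ u) - (w - u)⁻¹) := by
  have hU := isOpen_norm_gt r
  have hs0 : 0 < s := hr.trans hrs
  have hru : r < ‖u‖ := hrs.trans hsu
  obtain ⟨G, hG, hGeq⟩ := exists_regular_part hΨ hru hd hne
  set z := Ψ u with hz
  have hΨ0 : ∀ w, R₀ ≤ ‖w‖ → Ψ w ≠ 0 := fun w hw => norm_pos_iff.1
    ((mul_pos ha (hR₀.trans_le hw)).trans_le (hgrow w hw).1)
  have hΨ'd := hΨ.deriv hU
  have key : ∀ᶠ R : ℝ in atTop, ‖(faberPolynomial Ψ (2 * R₀) m).eval z - u ^ m -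
      (2 * Real.pi * Complex.I : ℂ)⁻¹ •
        ∮ w in C(0, s), w ^ m * (deriv Ψ w / (Ψ w - z) - (w - u)⁻¹)‖ ≤
      (2 * d * ‖z‖ ^ (m + 1) / a ^ (m + 2)) * R⁻¹ := by
    filter_upwards [eventually_ge_atTop (2 * R₀), eventually_gt_atTop ‖u‖, eventually_gt_atTop s,
      eventually_ge_atTop (2 * ‖z‖ / a)] with R h1 h2 h3 h4
    have hR : 0 < R := by linarith
    have hnR : ∀ w ∈ Metric.sphere (0 : ℂ) R, ‖w‖ = R := fun w hw => by simpa using hw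
    have hlow : ∀ w ∈ Metric.sphere (0 : ℂ) R, a * R / 2 ≤ ‖Ψ w - z‖ := by
      intro w hw
      have h5 := (hgrow w (by rw [hnR w hw]; linarith)).1
      rw [hnR w hw] at h5
      rw [div_le_iff₀ ha] at h4
      have := norm_sub_norm_le (Ψ w) z
      linarith
    have hne' : ∀ w ∈ Metric.sphere (0 : ℂ) R, Ψ w - z ≠ 0 := fun w hw =>
      norm_pos_iff.1 ((by positivity : 0 < a * R / 2).trans_le (hlow w hw))
    have hsubR : Metric.sphere (0 : ℂ) R ⊆ {w | r < ‖w‖} := fun w hw => by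
      change r < ‖w‖
      rw [hnR w hw]; linarith
    have hcΨ := hΨ.continuousOn.mono hsubR
    have hcΨ' := hΨ'd.continuousOn.mono hsubR
    have hΨ0R : ∀ w ∈ Metric.sphere (0 : ℂ) R, Ψ w ≠ 0 := fun w hw =>
      hΨ0 w (by rw [hnR w hw]; linarith)
    have hcpow : ContinuousOn (fun w : ℂ => w ^ m) (Metric.sphere 0 R) := by fun_prop
    -- `Ψ` has no zero for `‖w‖ ≥ R₀`, so the defining circle can be pushed out to radius `R`.
    have hcoef : ∀ k : ℕ, (∮ w in C(0, 2 * R₀), w ^ m * deriv Ψ w / Ψ w ^ (k + 1)) =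
        ∮ w in C(0, R), w ^ m * deriv Ψ w / Ψ w ^ (k + 1) := by
      intro k
      refine (circleIntegral_eq_of_differentiableOn_annulus (a := R₀) (b := R + 1) hR₀.le
        (by linarith) h1 (by linarith) ?_).symm
      have hsub : {w : ℂ | R₀ < ‖w‖ ∧ ‖w‖ < R + 1} ⊆ {w | r < ‖w‖} := fun w hw =>
        hrR₀.trans hw.1
      exact ((differentiableOn_id.pow m).mul (hΨ'd.mono hsub)).div
        ((hΨ.mono hsub).pow (k + 1)) fun w hw => pow_ne_zero _ (hΨ0 w hw.1.le)
    have hcE : ContinuousOn (fun w => w ^ m * deriv Ψ w * (z ^ (m + 1) / (Ψ w ^ (m + 1) *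
        (Ψ w - z)))) (Metric.sphere 0 R) :=
      (hcpow.mul hcΨ').mul (continuousOn_const.div ((hcΨ.pow _).mul (hcΨ.sub continuousOn_const))
        fun w hw => mul_ne_zero (pow_ne_zero _ (hΨ0R w hw)) (hne' w hw))
    have hcM : ContinuousOn (fun w => w ^ m * deriv Ψ w * (Ψ w - z)⁻¹) (Metric.sphere 0 R) :=
      (hcpow.mul hcΨ').mul ((hcΨ.sub continuousOn_const).inv₀ hne')
    have heval : (faberPolynomial Ψ (2 * R₀) m).eval z = (2 * Real.pi * Complex.I : ℂ)⁻¹ •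
        ((∮ w in C(0, R), w ^ m * deriv Ψ w * (Ψ w - z)⁻¹) -
          ∮ w in C(0, R), w ^ m * deriv Ψ w * (z ^ (m + 1) / (Ψ w ^ (m + 1) * (Ψ w - z)))) := by
      rw [← circleIntegral.integral_sub (hcM.circleIntegrable hR.le)
        (hcE.circleIntegrable hR.le), faberPolynomial, Polynomial.eval_finsetSum]
      simp only [Polynomial.eval_mul, Polynomial.eval_C, Polynomial.eval_pow, Polynomial.eval_X,
        smul_eq_mul, mul_assoc, hcoef]
      rw [← Finset.mul_sum]
      congr 1
      have : ∀ k ∈ Finset.range (m + 1),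
          (∮ w in C(0, R), w ^ m * deriv Ψ w / Ψ w ^ (k + 1)) * z ^ k =
            ∮ w in C(0, R), z ^ k * (w ^ m * deriv Ψ w / Ψ w ^ (k + 1)) := fun k _ => by
        rw [circleIntegral.integral_const_mul, mul_comm]
      rw [Finset.sum_congr rfl this, ← circleIntegral.integral_fun_sum]
      · refine circleIntegral.integral_congr hR.le fun w hw => ?_
        have h5 := geom_expansion (hΨ0R w hw) (hne' w hw) m
        rw [← mul_assoc, ← mul_assoc, ← mul_sub, ← h5, Finset.mul_sum]
        refine Finset.sum_congr rfl fun k _ => ?_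
        ring
      · intro k _
        refine ContinuousOn.circleIntegrable hR.le (continuousOn_const.mul
          ((hcpow.mul hcΨ').div (hcΨ.pow _) fun w hw => pow_ne_zero _ (hΨ0R w hw)))
    have hnu : ∀ t : ℝ, t ≠ ‖u‖ → ∀ w ∈ Metric.sphere (0 : ℂ) t, w ≠ u := by
      rintro t ht w hw rfl
      simp at hw
      exact ht hw.symm
    have hcI : ContinuousOn (fun w : ℂ => (w - u)⁻¹ • w ^ m) (Metric.sphere 0 R) :=
      ((continuousOn_id.sub continuousOn_const).inv₀ fun w hw =>
        sub_ne_zero.2 (hnu R h2.ne' w hw)).smul hcpow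
    have hcG : ContinuousOn (fun w => w ^ m * G w) (Metric.sphere 0 R) :=
      hcpow.mul (hG.continuousOn.mono hsubR)
    have hmain : (2 * Real.pi * Complex.I : ℂ)⁻¹ •
        (∮ w in C(0, R), w ^ m * deriv Ψ w * (Ψ w - z)⁻¹) = u ^ m +
        (2 * Real.pi * Complex.I : ℂ)⁻¹ •
          ∮ w in C(0, s), w ^ m * (deriv Ψ w / (Ψ w - z) - (w - u)⁻¹) := by
      have e1 : (∮ w in C(0, R), w ^ m * deriv Ψ w * (Ψ w - z)⁻¹) =
          (∮ w in C(0, R), (w - u)⁻¹ • w ^ m) + ∮ w in C(0, R), w ^ m * G w := by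
        rw [← circleIntegral.integral_add (hcI.circleIntegrable hR.le)
          (hcG.circleIntegrable hR.le)]
        refine circleIntegral.integral_congr hR.le fun w hw => ?_
        simp only [smul_eq_mul]
        rw [hGeq w (hsubR hw) (hnu R h2.ne' w hw)]
        ring
      have e2 : (∮ w in C(0, R), w ^ m * G w) = ∮ w in C(0, s), w ^ m * G w :=
        circleIntegral_eq_of_differentiableOn_annulus hr.le hrs h3.le (lt_add_one R)
          ((differentiableOn_id.pow m).mul (hG.mono fun w hw => hw.1))
      have e3 : (∮ w in C(0, s), w ^ m * G w) =
          ∮ w in C(0, s), w ^ m * (deriv Ψ w / (Ψ w - z) - (w - u)⁻¹) := by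
        refine circleIntegral.integral_congr hs0.le fun w hw => ?_
        have hw' : ‖w‖ = s := by simpa using hw
        rw [hGeq w (by rw [hw']; exact hrs) (hnu s hsu.ne w hw)]
      have e4 : (2 * Real.pi * Complex.I : ℂ)⁻¹ • (∮ w in C(0, R), (w - u)⁻¹ • w ^ m) = u ^ m :=
        DiffContOnCl.two_pi_i_inv_smul_circleIntegral_sub_inv_smul
          (differentiable_id.pow m).diffContOnCl (by simpa using h2)
      rw [e1, smul_add, e4, e2, e3]
    rw [heval, smul_sub, hmain]
    rw [show ∀ x y w : ℂ, x + y - w - x - y = -w from fun x y w => by ring, norm_neg]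
    have hbound : ∀ w ∈ Metric.sphere (0 : ℂ) R,
        ‖w ^ m * deriv Ψ w * (z ^ (m + 1) / (Ψ w ^ (m + 1) * (Ψ w - z)))‖ ≤
          R ^ m * d * (‖z‖ ^ (m + 1) / ((a * R) ^ (m + 1) * (a * R / 2))) := by
      intro w hw
      have h5 := hgrow w (by rw [hnR w hw]; linarith)
      rw [hnR w hw] at h5
      have h6 := hlow w hw
      rw [norm_mul, norm_mul, norm_div, norm_mul, norm_pow, norm_pow, norm_pow, hnR w hw]
      gcongr
      · exact h5.2
      · exact h5.1
    refine (circleIntegral.norm_two_pi_i_inv_smul_integral_le_of_norm_le_const hR.le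
      hbound).trans (le_of_eq ?_)
    have : R ≠ 0 := hR.ne'
    have : a ≠ 0 := ha.ne'
    rw [mul_pow]
    field_simp
    ring
  rw [← sub_eq_zero, ← norm_le_zero_iff]
  refine ge_of_tendsto ?_ key
  have := (tendsto_inv_atTop_zero (𝕜 := ℝ)).const_mul (2 * d * ‖z‖ ^ (m + 1) / a ^ (m + 2))
  simpa using this

/-- Polynomials approximating the powers of the exterior conformal map geometrically fast. -/
theorem exists_faber_approximation (hΨ : DifferentiableOn ℂ Ψ {w | r < ‖w‖}) (hr : 0 < r)
    (hr1 : r < 1) {c : ℂ} (hc : c ≠ 0)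
    (hlim : Tendsto (fun w => Ψ w / w) (Bornology.cobounded ℂ) (𝓝 c))
    (hinj : Set.InjOn Ψ {w | 1 ≤ ‖w‖})
    (hne : ∀ w u, r < ‖w‖ → ‖w‖ < 1 → 1 ≤ ‖u‖ → Ψ w ≠ Ψ u) (B : ℝ) :
    ∃ P : ℕ → Polynomial ℂ, (∀ m, (P m).natDegree ≤ m) ∧ ∃ C s : ℝ, 0 < s ∧ s < 1 ∧
      ∀ m u, 1 ≤ ‖u‖ → ‖u‖ < B → ‖(P m).eval (Ψ u) - u ^ m‖ ≤ C * s ^ m := by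
  obtain ⟨R, hR1, hrR, a, ha, d, hd, hgrow⟩ := exists_growth_bounds hΨ hc hlim
  set s := (r + 1) / 2 with hs
  have hrs : r < s := by rw [hs]; linarith
  have hs1 : s < 1 := by rw [hs]; linarith
  have hs0 : 0 < s := hr.trans hrs
  have hU := isOpen_norm_gt r
  have hΨ'd := hΨ.deriv hU
  set A : Set ℂ := {u | 1 ≤ ‖u‖} ∩ Metric.closedBall 0 B with hA
  have hAc : IsCompact A :=
    (isCompact_closedBall 0 B).inter_left (isClosed_le continuous_const continuous_norm)
  have hsph : ∀ w ∈ Metric.sphere (0 : ℂ) s, ‖w‖ = s := fun w hw => by simpa using hw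
  -- Values of `Ψ` on the circle of radius `s < 1` are not taken on `‖u‖ ≥ 1`, so the kernel is
  -- continuous up to `‖u‖ = 1` and compactness bounds it uniformly in `u`.
  have hcont : ContinuousOn (fun p : ℂ × ℂ => deriv Ψ p.1 / (Ψ p.1 - Ψ p.2) - (p.1 - p.2)⁻¹)
      (Metric.sphere (0 : ℂ) s ×ˢ A) := by
    have h1 : Set.MapsTo Prod.fst (Metric.sphere (0 : ℂ) s ×ˢ A) {w | r < ‖w‖} := fun p hp => by
      change r < ‖p.1‖
      rw [hsph _ hp.1]; exact hrs
    have h2 : Set.MapsTo Prod.snd (Metric.sphere (0 : ℂ) s ×ˢ A) {w | r < ‖w‖} := fun p hp =>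
      hr1.trans_le hp.2.1
    refine ((hΨ'd.continuousOn.comp continuousOn_fst h1).div
      ((hΨ.continuousOn.comp continuousOn_fst h1).sub (hΨ.continuousOn.comp continuousOn_snd h2))
      fun p hp => ?_).sub ((continuousOn_fst.sub continuousOn_snd).inv₀ fun p hp => ?_)
    · exact sub_ne_zero.2 (hne _ _ (h1 hp) (by rw [hsph _ hp.1]; exact hs1) hp.2.1)
    · refine sub_ne_zero.2 fun h => ?_
      have h3 : 1 ≤ ‖p.2‖ := hp.2.1
      rw [← h, hsph _ hp.1] at h3
      linarith
  obtain ⟨C, hC⟩ := ((isCompact_sphere (0 : ℂ) s).prod hAc).exists_bound_of_continuousOn hcont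
  have hopen : ∀ m u, 1 < ‖u‖ → ‖u‖ < B →
      ‖(faberPolynomial Ψ (2 * R) m).eval (Ψ u) - u ^ m‖ ≤ s * C * s ^ m := by
    intro m u h1 h2
    have hne' : ∀ w, r < ‖w‖ → w ≠ u → Ψ w ≠ Ψ u := by
      intro w hw hwu
      rcases lt_or_ge ‖w‖ 1 with h | h
      · exact hne w u hw h h1.le
      · exact fun he => hwu (hinj h h1.le he)
    have hdu : deriv Ψ u ≠ 0 := deriv_ne_zero_of_injOn (isOpen_norm_gt 1)
      (hΨ.mono fun w hw => hr1.trans hw) (hinj.mono fun w hw => le_of_lt (show 1 < ‖w‖ from hw)) h1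
    rw [eval_faberPolynomial hΨ hr (by linarith) hrR ha hd hgrow hrs (hs1.trans h1) hdu hne' m]
    refine (circleIntegral.norm_two_pi_i_inv_smul_integral_le_of_norm_le_const hs0.le
      (C := s ^ m * C) fun w hw => ?_).trans (le_of_eq (by ring))
    rw [norm_mul, norm_pow, hsph w hw]
    exact mul_le_mul_of_nonneg_left (hC (w, u) ⟨hw, h1.le, by simpa using h2.le⟩) (by positivity)
  refine ⟨faberPolynomial Ψ (2 * R), natDegree_faberPolynomial_le Ψ _, s * C, s, hs0, hs1, ?_⟩
  intro m u h1 h2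
  have hu0 : 0 < ‖u‖ := by linarith
  -- `Ψ' u ≠ 0` was derived from injectivity on the open set `‖u‖ > 1`; the circle itself is reached
  -- by a radial limit.
  have ht : Tendsto (fun t : ℝ => (t : ℂ) * u) (𝓝[>] 1) (𝓝 u) := by
    have : Continuous fun t : ℝ => (t : ℂ) * u := by fun_prop
    simpa using (this.tendsto 1).mono_left nhdsWithin_le_nhds
  have hcu : ContinuousAt (fun x => ‖(faberPolynomial Ψ (2 * R) m).eval (Ψ x) - x ^ m‖) u := by
    have h3 : ContinuousAt Ψ u :=
      (hΨ.differentiableAt (hU.mem_nhds (hr1.trans_le h1))).continuousAt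
    have h4 : ContinuousAt (fun x => (faberPolynomial Ψ (2 * R) m).eval (Ψ x)) u :=
      ContinuousAt.comp (faberPolynomial Ψ (2 * R) m).continuous.continuousAt h3
    exact (h4.sub (continuousAt_id.pow m)).norm
  refine le_of_tendsto (hcu.tendsto.comp ht) ?_
  have hB' : 1 < B / ‖u‖ := (one_lt_div hu0).2 h2
  filter_upwards [Ioo_mem_nhdsGT hB'] with t htm
  have h5 : ‖(t : ℂ) * u‖ = t * ‖u‖ := by
    rw [norm_mul, Complex.norm_real, Real.norm_of_nonneg (by linarith [htm.1])]
  refine hopen m _ ?_ ?_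
  · rw [h5]; nlinarith [htm.1]
  · rw [h5]; exact (lt_div_iff₀ hu0).1 htm.2

end Faber

/-! ### The exterior disk algebra and polynomial approximation -/

theorem closure_image_coe_union_infty_preimage (Ω : Set ℂ) :
    ((↑) : ℂ → OnePoint ℂ) ⁻¹' closure (((↑) : ℂ → OnePoint ℂ) '' Ω ∪ {OnePoint.infty}) =
      closure Ω := by
  rw [OnePoint.isOpenMap_coe.preimage_closure_eq_closure_preimage OnePoint.continuous_coe]
  congr 1
  ext x
  simp

/-- The chart at infinity of a function on the Riemann sphere. -/
noncomputable def chartAtInfty (f : OnePoint ℂ → ℂ) (w : ℂ) : ℂ :=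
  if w = 0 then f OnePoint.infty else f ((w⁻¹ : ℂ) : OnePoint ℂ)

theorem tendsto_infty_of_continuousAt_chart {f : OnePoint ℂ → ℂ}
    (h : ContinuousAt (chartAtInfty f) 0) :
    Tendsto (fun ζ : ℂ => f ζ) (Bornology.cobounded ℂ) (𝓝 (f OnePoint.infty)) := by
  have h0 : chartAtInfty f 0 = f OnePoint.infty := if_pos rfl
  have h1 := h.tendsto.comp (tendsto_inv₀_cobounded (α := ℂ))
  rw [h0] at h1
  refine h1.congr' ?_
  filter_upwards [Bornology.eventually_ne_cobounded 0] with ζ hζ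
  simp [chartAtInfty, hζ]

/-- Continuity at infinity is contained in analyticity of the chart there, so only finite points
need a continuity hypothesis. -/
theorem isExteriorDiskAlgebra_of_continuousOn {Ω : Set ℂ} {f : OnePoint ℂ → ℂ}
    (hc : ContinuousOn (fun ζ : ℂ => f ζ) (closure Ω))
    (ha : AnalyticOnNhd ℂ (fun ζ : ℂ => f ζ) Ω) (hinf : AnalyticAt ℂ (chartAtInfty f) 0) :
    IsExteriorDiskAlgebra Ω f := by
  refine ⟨fun x hx => ?_, ha, hinf⟩
  induction x using OnePoint.rec with
  | infty =>
    refine ContinuousAt.continuousWithinAt (OnePoint.continuousAt_infty'.2 ?_)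
    rw [coclosedCompact_eq_cocompact, ← Metric.cobounded_eq_cocompact]
    exact tendsto_infty_of_continuousAt_chart hinf.continuousAt
  | coe ζ =>
    have hζ : ζ ∈ closure Ω := by rw [← closure_image_coe_union_infty_preimage]; exact hx
    rw [ContinuousWithinAt, OnePoint.nhdsWithin_coe, closure_image_coe_union_infty_preimage,
      tendsto_map'_iff]
    exact hc ζ hζ

theorem IsExteriorDiskAlgebra.continuousOn_coe {Ω : Set ℂ} {f : OnePoint ℂ → ℂ}
    (hf : IsExteriorDiskAlgebra Ω f) : ContinuousOn (fun ζ : ℂ => f ζ) (closure Ω) :=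
  hf.1.comp OnePoint.continuous_coe.continuousOn fun ζ hζ => by
    rwa [← closure_image_coe_union_infty_preimage] at hζ

/-- Uniform polynomial approximation in the disk algebra. -/
theorem exists_polynomial_approx_of_diskAlgebra {F : ℂ → ℂ}
    (hc : ContinuousOn F (Metric.closedBall 0 1)) (hd : DifferentiableOn ℂ F (Metric.ball 0 1))
    {ε : ℝ} (hε : 0 < ε) :
    ∃ Q : Polynomial ℂ, ∀ s ∈ Metric.closedBall (0 : ℂ) 1, ‖Q.eval s - F s‖ < ε := by
  obtain ⟨δ, hδ, huc⟩ := Metric.uniformContinuousOn_iff.1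
    ((isCompact_closedBall (0 : ℂ) 1).uniformContinuousOn_of_continuous hc) (ε / 2) (by positivity)
  -- The dilate `F (ρ s)` is uniformly close to `F` and holomorphic past the unit circle, so its
  -- Taylor polynomials converge uniformly on the closed disc. The bound `1 / 2` keeps `ρ` positive.
  obtain ⟨ρ, hρ⟩ := exists_between (show max (1 - δ) (1 / 2) < 1 from
    max_lt (by linarith) (by norm_num))
  have hρδ : 1 - δ < ρ := (le_max_left _ _).trans_lt hρ.1
  have hρ0 : 0 < ρ := by linarith [(le_max_right (1 - δ) (1 / 2 : ℝ)).trans_lt hρ.1]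
  have hρ1 := hρ.2
  obtain ⟨R, hR1, hRρ⟩ := exists_between ((one_lt_inv₀ hρ0).2 hρ1)
  have hR0 : 0 < R := one_pos.trans hR1
  obtain ⟨R', hR'1, hR'R⟩ := exists_between hR1
  lift R to NNReal using hR0.le
  lift R' to NNReal using (one_pos.trans hR'1).le
  set H : ℂ → ℂ := fun s => F (ρ * s) with hH
  have hnorm : ∀ s : ℂ, ‖(ρ : ℂ) * s‖ = ρ * ‖s‖ := fun s => by
    rw [norm_mul, Complex.norm_real, Real.norm_of_nonneg hρ0.le]
  have hHd : DifferentiableOn ℂ H (Metric.closedBall 0 R) := by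
    refine hd.comp (by fun_prop) fun s hs => ?_
    rw [mem_closedBall_zero_iff] at hs
    rw [mem_ball_zero_iff, hnorm]
    calc ρ * ‖s‖ ≤ ρ * R := by gcongr
      _ < ρ * ρ⁻¹ := by gcongr
      _ = 1 := mul_inv_cancel₀ hρ0.ne'
  have hps := hHd.hasFPowerSeriesOnBall (by exact_mod_cast hR0)
  have hunif := hps.tendstoUniformlyOn' (r' := R') (by exact_mod_cast hR'R)
  obtain ⟨n, hn⟩ := (Metric.tendstoUniformlyOn_iff.1 hunif (ε / 2) (by positivity)).exists
  set p := cauchyPowerSeries H 0 R with hp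
  refine ⟨∑ k ∈ Finset.range n, Polynomial.C (p.coeff k) * Polynomial.X ^ k, fun s hs => ?_⟩
  rw [mem_closedBall_zero_iff] at hs
  have h1 := hn s (by rw [mem_ball_zero_iff]; exact hs.trans_lt hR'1)
  have h2 : (∑ k ∈ Finset.range n, Polynomial.C (p.coeff k) * Polynomial.X ^ k).eval s =
      p.partialSum n (s - 0) := by
    rw [Polynomial.eval_finsetSum, FormalMultilinearSeries.partialSum]
    refine Finset.sum_congr rfl fun k _ => ?_
    rw [sub_zero, Polynomial.eval_mul, Polynomial.eval_C, Polynomial.eval_pow, Polynomial.eval_X,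
      FormalMultilinearSeries.apply_eq_pow_smul_coeff, smul_eq_mul, mul_comm]
  have h3 : dist ((ρ : ℂ) * s) s < δ := by
    have : (ρ : ℂ) * s - s = ((1 - ρ : ℝ) : ℂ) * (-s) := by push_cast; ring
    rw [dist_eq_norm, this, norm_mul, Complex.norm_real, Real.norm_of_nonneg (by linarith),
      norm_neg]
    nlinarith [norm_nonneg s]
  have h4 := huc (ρ * s) (by
    rw [mem_closedBall_zero_iff, hnorm]; nlinarith [norm_nonneg s]) s (by simpa using hs) h3
  rw [h2, ← dist_eq_norm]
  rw [dist_comm] at h1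
  calc dist (p.partialSum n (s - 0)) (F s) ≤ dist (p.partialSum n (s - 0)) (H s) +
        dist (H s) (F s) := dist_triangle _ _ _
    _ < ε / 2 + ε / 2 := add_lt_add h1 h4
    _ = ε := add_halves ε

/-- The inverse of an injective continuous map with a pole at infinity is continuous. -/
theorem continuousOn_invFunOn_of_tendsto_cobounded {Ψ : ℂ → ℂ} {E : Set ℂ} (hE : IsClosed E)
    (hΨ : ∀ w ∈ E, ContinuousAt Ψ w) (hinj : Set.InjOn Ψ E)
    (hlim : Tendsto Ψ (Bornology.cobounded ℂ) (Bornology.cobounded ℂ)) :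
    ContinuousOn (Function.invFunOn Ψ E) (Ψ '' E) := by
  rintro _ ⟨w, hw, rfl⟩
  have hg := hinj.leftInvOn_invFunOn
  rw [ContinuousWithinAt, hg hw]
  have h1 := (tendsto_norm_cobounded_atTop.comp hlim).eventually (eventually_gt_atTop (‖Ψ w‖ + 1))
  obtain ⟨C, -, hC⟩ := (Metric.hasBasis_cobounded_compl_closedBall (0 : ℂ)).eventually_iff.1 h1
  -- Near `Ψ w` the inverse takes values in a compact set, as `Ψ` is large outside it. `Ψ` sends
  -- every cluster point to `Ψ w`, so injectivity leaves only `w`.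
  refine ((isCompact_closedBall (0 : ℂ) C).inter_left hE).tendsto_nhds_of_unique_mapClusterPt ?_ ?_
  · filter_upwards [self_mem_nhdsWithin, nhdsWithin_le_nhds
      (continuous_norm.continuousAt.eventually (gt_mem_nhds (lt_add_one ‖Ψ w‖)))]
    rintro _ ⟨x, hx, rfl⟩ h2
    rw [hg hx]
    refine ⟨hx, ?_⟩
    by_contra h3
    exact (lt_trans h2 (hC h3)).false
  · rintro x ⟨hxE, -⟩ hx
    have h2 := hx.continuousAt_comp (hΨ x hxE)
    have h3 : Tendsto (Ψ ∘ Function.invFunOn Ψ E) (𝓝[Ψ '' E] (Ψ w)) (𝓝 (Ψ w)) := by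
      refine (tendsto_id.mono_left nhdsWithin_le_nhds).congr' ?_
      filter_upwards [self_mem_nhdsWithin]
      rintro _ ⟨y, hy, rfl⟩
      simp [hg hy]
    have h4 : Ψ x = Ψ w := eq_of_nhds_neBot (NeBot.mono h2 (inf_le_inf_left _ h3))
    exact hinj hxE hw h4

theorem IsConformalOntoExterior.one_lt_norm {Φ : ℂ → ℂ} {Ω : Set ℂ}
    (hΦ : IsConformalOntoExterior Φ Ω) {ζ : ℂ} (hζ : ζ ∈ Ω) : 1 < ‖Φ ζ‖ :=
  hΦ.2.mapsTo hζ

/-- `Ψ` is a holomorphic extension across the unit circle of the inverse of the exterior conformal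
map `Φ`, injective up to the circle. -/
structure IsExteriorParametrization (Φ Ψ : ℂ → ℂ) (Ω : Set ℂ) (r : ℝ) : Prop where
  pos : 0 < r
  lt_one : r < 1
  differentiableOn : DifferentiableOn ℂ Ψ {w | r < ‖w‖}
  eq_inverse : ∀ w, 1 < ‖w‖ → Ψ w = exteriorInverse Φ Ω w
  injOn : Set.InjOn Ψ {w | 1 ≤ ‖w‖}
  image_circle : Ψ '' {w | ‖w‖ = 1} = frontier Ω
  ne : ∀ w u, r < ‖w‖ → ‖w‖ < 1 → 1 ≤ ‖u‖ → Ψ w ≠ Ψ u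

namespace IsExteriorParametrization

variable {Φ Ψ : ℂ → ℂ} {Ω : Set ℂ} {r M : ℝ}

theorem continuousAt (h : IsExteriorParametrization Φ Ψ Ω r) {w : ℂ} (hw : 1 ≤ ‖w‖) :
    ContinuousAt Ψ w :=
  (h.differentiableOn.differentiableAt
    ((isOpen_norm_gt r).mem_nhds (h.lt_one.trans_le hw))).continuousAt

theorem eventuallyEq_inverse (h : IsExteriorParametrization Φ Ψ Ω r) :
    Ψ =ᶠ[Bornology.cobounded ℂ] exteriorInverse Φ Ω := by
  filter_upwards [tendsto_norm_cobounded_atTop.eventually (eventually_gt_atTop (1 : ℝ))] with w hw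
  exact h.eq_inverse w hw

theorem tendsto_cobounded (h : IsExteriorParametrization Φ Ψ Ω r)
    (hΦ : IsConformalOntoExterior Φ Ω) (hΩ : IsOpen Ω) (hM : 0 < M)
    (hMΩ : {z : ℂ | M < ‖z‖} ⊆ Ω) :
    Tendsto Ψ (Bornology.cobounded ℂ) (Bornology.cobounded ℂ) :=
  (hΦ.tendsto_inverse_cobounded hΩ hM hMΩ).congr' h.eventuallyEq_inverse.symm

theorem apply_conformal (h : IsExteriorParametrization Φ Ψ Ω r)
    (hΦ : IsConformalOntoExterior Φ Ω) {ζ : ℂ} (hζ : ζ ∈ Ω) : Ψ (Φ ζ) = ζ := by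
  rw [h.eq_inverse _ (hΦ.2.mapsTo hζ), hΦ.leftInvOn hζ]

theorem mem (h : IsExteriorParametrization Φ Ψ Ω r) (hΦ : IsConformalOntoExterior Φ Ω) {w : ℂ}
    (hw : 1 < ‖w‖) : Ψ w ∈ Ω := by
  rw [h.eq_inverse w hw]; exact hΦ.inverse_mem hw

theorem image_eq_closure (h : IsExteriorParametrization Φ Ψ Ω r)
    (hΦ : IsConformalOntoExterior Φ Ω) : Ψ '' {w | 1 ≤ ‖w‖} = closure Ω := by
  rw [closure_eq_self_union_frontier, ← h.image_circle]
  ext ζ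
  constructor
  · rintro ⟨w, hw, rfl⟩
    rcases (show 1 ≤ ‖w‖ from hw).eq_or_lt with h1 | h1
    · exact Or.inr ⟨w, h1.symm, rfl⟩
    · exact Or.inl (h.mem hΦ h1)
  · rintro (hζ | ⟨w, hw, rfl⟩)
    · exact ⟨Φ ζ, (hΦ.one_lt_norm hζ).le, h.apply_conformal hΦ hζ⟩
    · exact ⟨w, (show ‖w‖ = 1 from hw).ge, rfl⟩

theorem mem_closure (h : IsExteriorParametrization Φ Ψ Ω r)
    (hΦ : IsConformalOntoExterior Φ Ω) {w : ℂ} (hw : 1 ≤ ‖w‖) : Ψ w ∈ closure Ω := by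
  rw [← h.image_eq_closure hΦ]; exact ⟨w, hw, rfl⟩

/-- A polynomial divided by a power of the conformal map belongs to the exterior disk algebra. -/
theorem exists_exteriorDiskAlgebra (h : IsExteriorParametrization Φ Ψ Ω r)
    (hΦ : IsConformalOntoExterior Φ Ω) (hΩ : IsOpen Ω) (hM : 0 < M)
    (hMΩ : {z : ℂ | M < ‖z‖} ⊆ Ω) {n : ℕ} {p : Polynomial ℂ} (hp : p.natDegree ≤ n) {z : ℂ}
    (hz : z ∈ Ω) (hpz : p.eval z = 1) :
    ∃ f : OnePoint ℂ → ℂ, IsExteriorDiskAlgebra Ω f ∧ f (z : OnePoint ℂ) = 1 ∧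
      ∀ ζ ∈ frontier Ω, ‖f (ζ : OnePoint ℂ)‖ = ‖Φ z‖ ^ n * ‖p.eval ζ‖ := by
  have hΦ0 : ∀ ζ ∈ Ω, Φ ζ ≠ 0 := fun ζ hζ => norm_pos_iff.1 (one_pos.trans (hΦ.2.mapsTo hζ))
  have hg := h.injOn.leftInvOn_invFunOn
  -- `g` is the continuous extension of `Φ` to `closure Ω`, unimodular on the frontier.
  set g := Function.invFunOn Ψ {w | 1 ≤ ‖w‖} with hgdef
  have hgΩ : ∀ ζ ∈ Ω, g ζ = Φ ζ := fun ζ hζ => by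
    conv_lhs => rw [← h.apply_conformal hΦ hζ]
    exact hg (hΦ.one_lt_norm hζ).le
  have hgmem : ∀ ζ ∈ closure Ω, 1 ≤ ‖g ζ‖ := by
    intro ζ hζ
    rw [← h.image_eq_closure hΦ] at hζ
    exact Function.invFunOn_mem hζ
  have hgc : ContinuousOn g (closure Ω) := by
    rw [← h.image_eq_closure hΦ]
    exact continuousOn_invFunOn_of_tendsto_cobounded (isClosed_le continuous_const continuous_norm)
      (fun w hw => h.continuousAt hw) h.injOn (h.tendsto_cobounded hΦ hΩ hM hMΩ)
  obtain ⟨k, hk, hk0, hkΦ⟩ := exists_analyticAt_inv_of_tendsto_cobounded (hΦ.1.mono hMΩ)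
    (hΦ.tendsto_cobounded hΩ hM hMΩ)
  have hk1 : AnalyticAt ℂ (dslope k 0) 0 := by
    obtain ⟨q, hq⟩ := hk
    exact ⟨_, hq.has_fpower_series_dslope_fslope⟩
  -- The reversed polynomial `s^n p(1/s)`. As `1/Φ(1/s) = s * dslope k 0 s`, the quotient `p / Φ^n`
  -- becomes `q * (dslope k 0)^n` at infinity, which also dictates the value of `f` there.
  set q : ℂ → ℂ := fun s => ∑ i ∈ Finset.range (n + 1), p.coeff i * s ^ (n - i) with hq
  have hqan : AnalyticAt ℂ q 0 := by
    have : Differentiable ℂ q := by fun_prop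
    exact this.analyticAt 0
  have hpq : ∀ s : ℂ, s ≠ 0 → p.eval s⁻¹ * s ^ n = q s := by
    intro s hs
    rw [Polynomial.eval_eq_sum_range' (Nat.lt_succ_of_le hp), Finset.sum_mul]
    refine Finset.sum_congr rfl fun i hi => ?_
    have hin : i ≤ n := Finset.mem_range_succ_iff.1 hi
    rw [mul_assoc]
    congr 1
    conv_lhs => rw [← Nat.sub_add_cancel hin, pow_add]
    rw [inv_pow]
    field_simp
  set f : OnePoint ℂ → ℂ := fun x =>
    x.elim (q 0 * Φ z ^ n * dslope k 0 0 ^ n) fun ζ => p.eval ζ * Φ z ^ n * (g ζ)⁻¹ ^ n with hf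
  have hfζ : ∀ ζ : ℂ, f ζ = p.eval ζ * Φ z ^ n * (g ζ)⁻¹ ^ n := fun ζ => rfl
  have hfΩ : ∀ ζ ∈ Ω, f ζ = p.eval ζ * Φ z ^ n * (Φ ζ)⁻¹ ^ n := fun ζ hζ => by
    rw [hfζ, hgΩ ζ hζ]
  refine ⟨f, isExteriorDiskAlgebra_of_continuousOn ?_ ?_ ?_, ?_, ?_⟩
  · exact (p.continuous.continuousOn.mul continuousOn_const).mul
      ((hgc.inv₀ fun ζ hζ => norm_pos_iff.1 (one_pos.trans_le (hgmem ζ hζ))).pow n)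
  · refine DifferentiableOn.analyticOnNhd ?_ hΩ
    have h1 : DifferentiableOn ℂ (fun ζ => p.eval ζ * Φ z ^ n * (Φ ζ)⁻¹ ^ n) Ω :=
      (p.differentiable.differentiableOn.mul (differentiableOn_const _)).mul
        ((hΦ.1.inv hΦ0).pow n)
    exact h1.congr hfΩ
  · have h1 : AnalyticAt ℂ (fun s => q s * Φ z ^ n * dslope k 0 s ^ n) 0 :=
      (hqan.mul analyticAt_const).mul (hk1.pow n)
    refine h1.congr ?_
    have h2 : ∀ᶠ s in 𝓝 (0 : ℂ), s ≠ 0 → M < ‖s⁻¹‖ := eventually_nhdsWithin_iff.1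
      (tendsto_norm_inv_nhdsNE_zero_atTop.eventually (eventually_gt_atTop M))
    filter_upwards [h2] with s hs
    rcases eq_or_ne s 0 with rfl | hs0
    · simp [chartAtInfty, hf]
    · rw [chartAtInfty, if_neg hs0, hfΩ _ (hMΩ (hs hs0)), ← hkΦ s hs0, ← hpq s hs0]
      have h3 : s * dslope k 0 s = k s := by simpa [hk0] using sub_smul_dslope k 0 s
      rw [← h3, mul_pow]
      ring
  · rw [hfΩ z hz, hpz, one_mul, ← mul_pow, mul_inv_cancel₀ (hΦ0 z hz), one_pow]
  · intro ζ hζ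
    rw [← h.image_circle] at hζ
    obtain ⟨w, hw, rfl⟩ := hζ
    have hw' : ‖w‖ = 1 := hw
    have : g (Ψ w) = w := hg hw'.ge
    rw [hfζ, this, norm_mul, norm_mul, norm_pow, norm_pow, norm_inv, hw']
    simp [mul_comm]

/-- Functions in the exterior disk algebra are uniformly approximable by polynomials in `1 / Φ`. -/
theorem exists_polynomial_approx (h : IsExteriorParametrization Φ Ψ Ω r)
    (hΦ : IsConformalOntoExterior Φ Ω) (hΩ : IsOpen Ω) (hM : 0 < M)
    (hMΩ : {z : ℂ | M < ‖z‖} ⊆ Ω) {f : OnePoint ℂ → ℂ} (hf : IsExteriorDiskAlgebra Ω f)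
    {ε : ℝ} (hε : 0 < ε) :
    ∃ Q : Polynomial ℂ, ∀ u : ℂ, 1 ≤ ‖u‖ → ‖Q.eval u⁻¹ - f (Ψ u : ℂ)‖ < ε := by
  have hlim := h.tendsto_cobounded hΦ hΩ hM hMΩ
  have hchart : AnalyticAt ℂ (chartAtInfty f) 0 := hf.2.2
  have hfinf := tendsto_infty_of_continuousAt_chart hchart.continuousAt
  -- The substitution `s ↦ Ψ(1/s)` carries the exterior algebra to the disk algebra, with infinity
  -- corresponding to zero.
  set F : ℂ → ℂ := Function.update (fun s => f (Ψ s⁻¹ : ℂ)) 0 (f OnePoint.infty) with hF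
  have hFs : ∀ s, s ≠ 0 → F s = f (Ψ s⁻¹ : ℂ) := fun s hs => Function.update_of_ne hs _ _
  have hF0 : ContinuousAt F 0 := by
    rw [hF, continuousAt_update_same]
    exact hfinf.comp (hlim.comp tendsto_inv₀_nhdsNE_zero)
  have hFeq : ∀ s : ℂ, s ≠ 0 → F =ᶠ[𝓝 s] fun s => f (Ψ s⁻¹ : ℂ) := fun s hs => by
    filter_upwards [isOpen_ne.mem_nhds hs] with t ht using hFs t ht
  have hFd : ∀ s : ℂ, s ≠ 0 → ‖s‖ < 1 → DifferentiableAt ℂ F s := by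
    intro s hs h1
    have h2 : 1 < ‖s⁻¹‖ := by rw [norm_inv]; exact (one_lt_inv₀ (norm_pos_iff.2 hs)).2 h1
    have h3 : DifferentiableAt ℂ Ψ s⁻¹ := h.differentiableOn.differentiableAt
      ((isOpen_norm_gt r).mem_nhds (h.lt_one.trans h2))
    have h4 : DifferentiableAt ℂ (fun ζ : ℂ => f ζ) (Ψ s⁻¹) :=
      (hf.2.1 _ (h.mem hΦ h2)).differentiableAt
    have h5 := DifferentiableAt.comp (f := fun x : ℂ => x⁻¹) s h3 (differentiableAt_inv hs)
    exact (DifferentiableAt.comp (g := fun ζ : ℂ => f ζ) s h4 h5).congr_of_eventuallyEq (hFeq s hs)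
  have hFc : ContinuousOn F (Metric.closedBall 0 1) := by
    intro s hs
    rcases eq_or_ne s 0 with rfl | hs0
    · exact hF0.continuousWithinAt
    · have hmaps : Set.MapsTo (fun s : ℂ => Ψ s⁻¹) (Metric.closedBall 0 1 \ {0}) (closure Ω) := by
        rintro t ⟨ht, ht0⟩
        refine h.mem_closure hΦ ?_
        rw [norm_inv]
        exact (one_le_inv₀ (norm_pos_iff.2 ht0)).2 (by simpa using ht)
      have h2 : 1 ≤ ‖s⁻¹‖ := by
        rw [norm_inv]; exact (one_le_inv₀ (norm_pos_iff.2 hs0)).2 (by simpa using hs)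
      have h3 : ContinuousAt (fun s : ℂ => Ψ s⁻¹) s :=
        ContinuousAt.comp (f := fun x : ℂ => x⁻¹) (h.continuousAt h2) (continuousAt_inv₀ hs0)
      have h4 : ContinuousWithinAt (fun s : ℂ => f (Ψ s⁻¹ : ℂ)) (Metric.closedBall 0 1 \ {0}) s :=
        ContinuousWithinAt.comp (g := fun ζ : ℂ => f ζ) (hf.continuousOn_coe _ (hmaps ⟨hs, hs0⟩))
          h3.continuousWithinAt hmaps
      have h5 : ContinuousWithinAt (fun s : ℂ => f (Ψ s⁻¹ : ℂ)) (Metric.closedBall 0 1) s := by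
        refine h4.mono_of_mem_nhdsWithin ?_
        exact inter_mem self_mem_nhdsWithin (nhdsWithin_le_nhds (isOpen_ne.mem_nhds hs0))
      exact h5.congr_of_eventuallyEq ((hFeq s hs0).filter_mono nhdsWithin_le_nhds) (hFs s hs0)
  have hFdb : DifferentiableOn ℂ F (Metric.ball 0 1) := by
    intro s hs
    rw [mem_ball_zero_iff] at hs
    rcases eq_or_ne s 0 with rfl | hs0
    · refine (Complex.analyticAt_of_differentiable_on_punctured_nhds_of_continuousAt ?_
        hF0).differentiableAt.differentiableWithinAt
      filter_upwards [self_mem_nhdsWithin,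
        nhdsWithin_le_nhds (Metric.ball_mem_nhds (0 : ℂ) one_pos)] with t h1 h2
      exact hFd t h1 (by simpa using h2)
    · exact (hFd s hs0 hs).differentiableWithinAt
  obtain ⟨Q, hQ⟩ := exists_polynomial_approx_of_diskAlgebra hFc hFdb hε
  refine ⟨Q, fun u hu => ?_⟩
  have hu0 : u⁻¹ ≠ 0 := inv_ne_zero (norm_pos_iff.1 (one_pos.trans_le hu))
  have h1 := hQ u⁻¹ (by
    rw [mem_closedBall_zero_iff, norm_inv]; exact inv_le_one_of_one_le₀ hu)
  rwa [hFs _ hu0, inv_inv] at h1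

/-- Polynomials behaving like `Φ ^ n * f` on the boundary and at a point. -/
theorem exists_polynomial_of_degree (h : IsExteriorParametrization Φ Ψ Ω r)
    (hΦ : IsConformalOntoExterior Φ Ω) (hΩ : IsOpen Ω) (hM : 0 < M)
    (hMΩ : {z : ℂ | M < ‖z‖} ⊆ Ω) {f : OnePoint ℂ → ℂ} (hf : IsExteriorDiskAlgebra Ω f)
    {ε : ℝ} (hε : 0 < ε) (B : ℝ) :
    ∀ᶠ n : ℕ in atTop, ∃ p : Polynomial ℂ, p.natDegree ≤ n ∧
      ∀ u : ℂ, 1 ≤ ‖u‖ → ‖u‖ < B → ‖p.eval (Ψ u) - u ^ n * f (Ψ u : ℂ)‖ ≤ ε * ‖u‖ ^ n := by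
  obtain ⟨Q, hQ⟩ := h.exists_polynomial_approx hΦ hΩ hM hMΩ hf (half_pos hε)
  obtain ⟨c, hc, hclim⟩ := hΦ.exists_tendsto_inverse_div hΩ hM hMΩ
  obtain ⟨P, hPdeg, C, s, hs0, hs1, hPC⟩ := exists_faber_approximation h.differentiableOn h.pos
    h.lt_one hc (hclim.congr' (by
      filter_upwards [h.eventuallyEq_inverse] with w hw; rw [hw])) h.injOn h.ne B
  set d := Q.natDegree with hd
  have hlim : Tendsto (fun n : ℕ => ∑ k ∈ Finset.range (d + 1), ‖Q.coeff k‖ * (C * s ^ (n - k)))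
      atTop (𝓝 0) := by
    have : Tendsto (fun n : ℕ => ∑ k ∈ Finset.range (d + 1), ‖Q.coeff k‖ * (C * s ^ (n - k)))
        atTop (𝓝 (∑ k ∈ Finset.range (d + 1), ‖Q.coeff k‖ * (C * 0))) :=
      tendsto_finsetSum _ fun k _ => (((tendsto_pow_atTop_nhds_zero_of_lt_one hs0.le hs1).comp
        (tendsto_sub_atTop_nat k)).const_mul C).const_mul _
    simpa using this
  filter_upwards [eventually_ge_atTop d, hlim.eventually (gt_mem_nhds (half_pos hε))] with n hn hsum
  -- In `u^n Q(1/u) = ∑ Q_k u^(n-k)` each power is replaced by its Faber approximant. Since `k ≤ d`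
  -- stays bounded, all errors `s^(n-k)` tend to zero.
  refine ⟨∑ k ∈ Finset.range (d + 1), Polynomial.C (Q.coeff k) * P (n - k), ?_, ?_⟩
  · refine Polynomial.natDegree_sum_le_of_forall_le _ _ fun k _ => ?_
    exact (Polynomial.natDegree_C_mul_le _ _).trans ((hPdeg _).trans (Nat.sub_le _ _))
  · intro u hu huB
    have hu0 : u ≠ 0 := norm_pos_iff.1 (one_pos.trans_le hu)
    have hun : 1 ≤ ‖u‖ ^ n := one_le_pow₀ hu
    have h1 : u ^ n * Q.eval u⁻¹ = ∑ k ∈ Finset.range (d + 1), Q.coeff k * u ^ (n - k) := by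
      rw [Polynomial.eval_eq_sum_range, Finset.mul_sum]
      refine Finset.sum_congr rfl fun k hk => ?_
      have hkn : k ≤ n := (Finset.mem_range_succ_iff.1 hk).trans hn
      conv_lhs => rw [← Nat.sub_add_cancel hkn, pow_add]
      rw [inv_pow]
      field_simp
    have h2 : ‖(∑ k ∈ Finset.range (d + 1), Polynomial.C (Q.coeff k) * P (n - k)).eval (Ψ u) -
        u ^ n * Q.eval u⁻¹‖ ≤ ε / 2 := by
      rw [h1, Polynomial.eval_finsetSum, ← Finset.sum_sub_distrib]
      refine (norm_sum_le _ _).trans (le_trans (Finset.sum_le_sum fun k _ => ?_) hsum.le)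
      rw [Polynomial.eval_mul, Polynomial.eval_C, ← mul_sub, norm_mul]
      exact mul_le_mul_of_nonneg_left (hPC _ u hu huB) (norm_nonneg _)
    have h3 : ‖u ^ n * Q.eval u⁻¹ - u ^ n * f (Ψ u : ℂ)‖ ≤ ‖u‖ ^ n * (ε / 2) := by
      rw [← mul_sub, norm_mul, norm_pow]
      exact mul_le_mul_of_nonneg_left (hQ u hu).le (by positivity)
    refine (norm_sub_le_norm_sub_add_norm_sub _ _ _).trans ((add_le_add h2 h3).trans ?_)
    nlinarith

end IsExteriorParametrization

/-! ### Comparison of the two extremal problems -/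

theorem bddBelow_christoffel (μ : Measure ℂ) (n : ℕ) (z : ℂ) :
    BddBelow {t : ℝ | ∃ p : Polynomial ℂ, p.natDegree ≤ n ∧ p.eval z = 1 ∧
      t = ∫ w, ‖p.eval w‖ ^ 2 ∂μ} := by
  refine ⟨0, ?_⟩
  rintro _ ⟨p, -, -, rfl⟩
  exact integral_nonneg fun w => by positivity

/-- The infimum of `∫ |f|²` over the exterior disk algebra normalized at `z`. -/
noncomputable def exteriorSzegoInf (Ω : Set ℂ) (μ : Measure ℂ) (z : ℂ) : ℝ :=
  sInf {t : ℝ | ∃ f : OnePoint ℂ → ℂ, IsExteriorDiskAlgebra Ω f ∧ f (z : OnePoint ℂ) = 1 ∧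
    t = ∫ w : ℂ, ‖f (w : OnePoint ℂ)‖ ^ 2 ∂μ}

namespace IsExteriorParametrization

variable {Φ Ψ : ℂ → ℂ} {Ω : Set ℂ} {r M : ℝ} {μ : Measure ℂ} {z : ℂ}

/-- A competitor `p` gives the competitor `Φ(z)^n p / Φ^n`, whose modulus on the support of
integration is `|Φ(z)|^n |p|`. -/
theorem exteriorSzegoInf_le_normChristoffelFn (h : IsExteriorParametrization Φ Ψ Ω r)
    (hΦ : IsConformalOntoExterior Φ Ω) (hΩ : IsOpen Ω) (hM : 0 < M)
    (hMΩ : {z : ℂ | M < ‖z‖} ⊆ Ω) (hμ : μ (frontier Ω)ᶜ = 0) (hz : z ∈ Ω) (n : ℕ) :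
    exteriorSzegoInf Ω μ z ≤ normChristoffelFn Φ μ n z := by
  have hΦz : 0 < ‖Φ z‖ ^ (2 * n) := pow_pos (one_pos.trans (hΦ.one_lt_norm hz)) _
  rw [normChristoffelFn, mul_comm, ← div_le_iff₀ hΦz]
  refine le_csInf ⟨_, 1, by simp, by simp, rfl⟩ ?_
  rintro _ ⟨p, hp, hpz, rfl⟩
  rw [div_le_iff₀ hΦz]
  obtain ⟨f, hf, hfz, hfΓ⟩ := h.exists_exteriorDiskAlgebra hΦ hΩ hM hMΩ hp hz hpz
  refine csInf_le ⟨0, ?_⟩ ⟨f, hf, hfz, ?_⟩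
  · rintro _ ⟨f, -, -, rfl⟩
    exact integral_nonneg fun w => by positivity
  · rw [← integral_mul_const]
    refine integral_congr_ae ?_
    filter_upwards [show ∀ᵐ w ∂μ, w ∈ frontier Ω from hμ] with w hw
    simp only [hfΓ w hw]
    ring

/-- Polynomials close to `Φ^n f` have modulus at least `(1 - ε)|Φ(z)|^n` at `z` and at most `|f| +
ε` on the frontier. Dividing by the value at `z` gives competitors in which the growing power
cancels. -/
theorem eventually_normChristoffelFn_lt [IsFiniteMeasure μ]
    (h : IsExteriorParametrization Φ Ψ Ω r) (hΦ : IsConformalOntoExterior Φ Ω) (hΩ : IsOpen Ω)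
    (hM : 0 < M) (hMΩ : {z : ℂ | M < ‖z‖} ⊆ Ω) (hμ : μ (frontier Ω)ᶜ = 0) (hz : z ∈ Ω)
    {f : OnePoint ℂ → ℂ} (hf : IsExteriorDiskAlgebra Ω f) (hfz : f (z : OnePoint ℂ) = 1) {b : ℝ}
    (hb : ∫ w : ℂ, ‖f (w : OnePoint ℂ)‖ ^ 2 ∂μ < b) :
    ∀ᶠ n : ℕ in atTop, normChristoffelFn Φ μ n z < b := by
  have hΦ1 := hΦ.one_lt_norm hz
  have hae : ∀ᵐ w ∂μ, w ∈ frontier Ω := hμ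
  have hΓc : IsCompact (frontier Ω) := by
    rw [← h.image_circle]
    have : {w : ℂ | ‖w‖ = 1} = Metric.sphere 0 1 := by ext; simp
    rw [this]
    exact (isCompact_sphere (0 : ℂ) 1).image_of_continuousOn fun w hw =>
      (h.continuousAt (le_of_eq (by simpa using hw.symm))).continuousWithinAt
  have hfc : ContinuousOn (fun w : ℂ => f w) (frontier Ω) :=
    hf.continuousOn_coe.mono frontier_subset_closure
  have hint : ∀ g : ℂ → ℝ, ContinuousOn g (frontier Ω) → Integrable g μ := by
    intro g hg
    have := hg.integrableOn_compact (μ := μ) hΓc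
    rwa [IntegrableOn, Measure.restrict_eq_self_of_ae_mem hae] at this
  set I₂ := ∫ w : ℂ, ‖f (w : OnePoint ℂ)‖ ^ 2 ∂μ with hI₂
  set I₁ := ∫ w : ℂ, ‖f (w : OnePoint ℂ)‖ ∂μ with hI₁
  have hexp : ∀ ε : ℝ, ∫ w : ℂ, (‖f (w : OnePoint ℂ)‖ + ε) ^ 2 ∂μ =
      I₂ + 2 * ε * I₁ + ε ^ 2 * μ.real Set.univ := by
    intro ε
    have e1 : ∀ w : ℂ, (‖f (w : OnePoint ℂ)‖ + ε) ^ 2 =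
        ‖f (w : OnePoint ℂ)‖ ^ 2 + 2 * ε * ‖f (w : OnePoint ℂ)‖ + ε ^ 2 := fun w => by ring
    simp only [e1]
    have i2 : Integrable (fun w : ℂ => ‖f (w : OnePoint ℂ)‖ ^ 2) μ := hint _ (hfc.norm.pow 2)
    have i1 : Integrable (fun w : ℂ => 2 * ε * ‖f (w : OnePoint ℂ)‖) μ :=
      (hint _ hfc.norm).const_mul (2 * ε)
    have i3 : Integrable (fun w : ℂ => ‖f (w : OnePoint ℂ)‖ ^ 2 + 2 * ε * ‖f (w : OnePoint ℂ)‖) μ :=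
      i2.add i1
    rw [integral_add i3 (integrable_const _), integral_add i2 i1, integral_const_mul,
      integral_const, smul_eq_mul, mul_comm (μ.real _)]
  -- The perturbed bound is continuous in `ε` at zero, where it equals `I₂ < b`.
  obtain ⟨ε, hε, hεb⟩ : ∃ ε ∈ Set.Ioo (0 : ℝ) 1,
      (I₂ + 2 * ε * I₁ + ε ^ 2 * μ.real Set.univ) / (1 - ε) ^ 2 < b := by
    have hc : ContinuousAt (fun ε : ℝ =>
        (I₂ + 2 * ε * I₁ + ε ^ 2 * μ.real Set.univ) / (1 - ε) ^ 2) 0 := by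
      refine ContinuousAt.div (by fun_prop) (by fun_prop) (by norm_num)
    have h1 : ∀ᶠ ε : ℝ in 𝓝[>] 0,
        (I₂ + 2 * ε * I₁ + ε ^ 2 * μ.real Set.univ) / (1 - ε) ^ 2 < b :=
      nhdsWithin_le_nhds (hc.eventually (gt_mem_nhds (by simpa using hb)))
    obtain ⟨ε, h2, h3⟩ := (h1.and (Ioo_mem_nhdsGT one_pos)).exists
    exact ⟨ε, h3, h2⟩
  -- The bound `‖Φ z‖ + 1` exceeds both `‖Φ z‖` and `1`, so one approximation serves at `z` and on
  -- the frontier.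
  filter_upwards [h.exists_polynomial_of_degree hΦ hΩ hM hMΩ hf hε.1 (‖Φ z‖ + 1)] with n hn
  obtain ⟨p, hpn, hp⟩ := hn
  have hpow : 0 < ‖Φ z‖ ^ n := pow_pos (one_pos.trans hΦ1) n
  have hpz : (1 - ε) * ‖Φ z‖ ^ n ≤ ‖p.eval z‖ := by
    have h1 := hp (Φ z) hΦ1.le (lt_add_one _)
    rw [h.apply_conformal hΦ hz, hfz, mul_one] at h1
    have h2 := norm_sub_norm_le (Φ z ^ n) (p.eval z)
    rw [norm_sub_rev, norm_pow] at h2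
    linarith
  have h1ε : 0 < 1 - ε := by linarith [hε.2]
  have hpz0 : 0 < ‖p.eval z‖ := (mul_pos h1ε hpow).trans_le hpz
  have hpΓ : ∀ w ∈ frontier Ω, ‖p.eval w‖ ≤ ‖f (w : OnePoint ℂ)‖ + ε := by
    intro w hw
    rw [← h.image_circle] at hw
    obtain ⟨u, hu, rfl⟩ := hw
    have hu' : ‖u‖ = 1 := hu
    have h1 := hp u hu'.ge (by rw [hu']; linarith)
    rw [hu', one_pow, mul_one] at h1
    have h2 := norm_sub_norm_le (p.eval (Ψ u)) (u ^ n * f (Ψ u : ℂ))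
    rw [norm_mul, norm_pow, hu', one_pow, one_mul] at h2
    linarith
  have hlam : christoffelFn μ n z ≤ ∫ w, ‖(Polynomial.C (p.eval z)⁻¹ * p).eval w‖ ^ 2 ∂μ := by
    refine csInf_le (bddBelow_christoffel μ n z)
      ⟨_, (Polynomial.natDegree_C_mul_le _ _).trans hpn, ?_, rfl⟩
    rw [Polynomial.eval_mul, Polynomial.eval_C, inv_mul_cancel₀ (norm_pos_iff.1 hpz0)]
  have hint2 : ∫ w, ‖(Polynomial.C (p.eval z)⁻¹ * p).eval w‖ ^ 2 ∂μ ≤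
      ‖p.eval z‖⁻¹ ^ 2 * (I₂ + 2 * ε * I₁ + ε ^ 2 * μ.real Set.univ) := by
    rw [← hexp, ← integral_const_mul]
    refine integral_mono_ae (hint _ ((Polynomial.continuous _).continuousOn.norm.pow 2))
      ((hint _ ((hfc.norm.add continuousOn_const).pow 2)).const_mul _) ?_
    filter_upwards [hae] with w hw
    rw [Polynomial.eval_mul, Polynomial.eval_C, norm_mul, norm_inv, mul_pow]
    gcongr
    exact hpΓ w hw
  have hJ : 0 ≤ I₂ + 2 * ε * I₁ + ε ^ 2 * μ.real Set.univ := by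
    rw [← hexp]; exact integral_nonneg fun w => by positivity
  refine lt_of_le_of_lt ?_ hεb
  calc normChristoffelFn Φ μ n z ≤ ‖Φ z‖ ^ (2 * n) *
        (‖p.eval z‖⁻¹ ^ 2 * (I₂ + 2 * ε * I₁ + ε ^ 2 * μ.real Set.univ)) :=
        mul_le_mul_of_nonneg_left (hlam.trans hint2) (by positivity)
    _ ≤ ‖Φ z‖ ^ (2 * n) * (((1 - ε) * ‖Φ z‖ ^ n)⁻¹ ^ 2 *
        (I₂ + 2 * ε * I₁ + ε ^ 2 * μ.real Set.univ)) := by gcongr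
    _ = _ := by
      rw [pow_mul']
      field_simp

end IsExteriorParametrization

theorem lemma4p2
    (K Ω Γ : Set ℂ) (hK : IsCompact K) (hKconn : IsConnected K) (hKsc : IsSimplyConnected K)
    (hΩ : Ω = unboundedComponent K) (hΓ : Γ = frontier Ω)
    (hΓan : IsRealAnalyticJordanCurve Γ)
    (Φ : ℂ → ℂ) (hΦ : IsConformalOntoExterior Φ Ω)
    (μ : Measure ℂ) [IsFiniteMeasure μ] (hμ : μ Γᶜ = 0)
    (z : ℂ) (hz : z ∈ Ω) :
    normChristoffelFnInf Φ μ z =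
        sInf {t : ℝ | ∃ f : OnePoint ℂ → ℂ, IsExteriorDiskAlgebra Ω f ∧ f (z : OnePoint ℂ) = 1 ∧
          t = ∫ w : ℂ, ‖f (w : OnePoint ℂ)‖ ^ 2 ∂μ} ∧
      Tendsto (fun n : ℕ => normChristoffelFn Φ μ n z) atTop
        (𝓝 (normChristoffelFnInf Φ μ z)) := by
  have hΩo : IsOpen Ω := by rw [hΩ]; exact isOpen_unboundedComponent hK
  obtain ⟨M, hM, hMΩ⟩ := exists_norm_gt_subset_unboundedComponent hK
  rw [← hΩ] at hMΩ
  subst hΓ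
  obtain ⟨r, hr0, hr1, Ψ, hΨd, hΨe, hΨi, hΨc, hΨn⟩ := hΦ.exists_extension hΩo hM hMΩ hΓan
  have h : IsExteriorParametrization Φ Ψ Ω r := ⟨hr0, hr1, hΨd, hΨe, hΨi, hΨc, hΨn⟩
  have hlim : Tendsto (fun n : ℕ => normChristoffelFn Φ μ n z) atTop
      (𝓝 (exteriorSzegoInf Ω μ z)) := by
    refine tendsto_order.2 ⟨fun b hb => Eventually.of_forall fun n => hb.trans_le
      (h.exteriorSzegoInf_le_normChristoffelFn hΦ hΩo hM hMΩ hμ hz n), fun b hb => ?_⟩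
    -- The case `n = 0`, `p = 1` supplies a competitor; nonemptiness is needed because the real
    -- `sInf` of the empty set is zero.
    obtain ⟨f₁, hf₁, hf₁z, -⟩ := h.exists_exteriorDiskAlgebra hΦ hΩo hM hMΩ (n := 0) (p := 1)
      (by simp) hz (by simp)
    obtain ⟨_, ⟨f, hf, hfz, rfl⟩, hfb⟩
      := exists_lt_of_csInf_lt (by exact ⟨_, f₁, hf₁, hf₁z, rfl⟩) hb
    exact h.eventually_normChristoffelFn_lt hΦ hΩo hM hMΩ hμ hz hf hfz hfb
  have heq : normChristoffelFnInf Φ μ z = exteriorSzegoInf Ω μ z := hlim.liminf_eq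
  exact ⟨heq, heq ▸ hlim⟩
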